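/- For reals $0\le\underline\sigma\le\overline\sigma<\infty$ let $G(a)=\frac12(\overline\sigma^2a^+-\underline\sigma^2a^-)$, $a\in\mathbb R$, and let $\mathcal G^0$ be the set of all such functions $G$. Let $C_{b,Lip}(\mathbb R)$ be the set of bounded Lipschitz functions on $\mathbb R$. For $G\in\mathcal G^0$ and $\varphi\in C_{b,Lip}(\mathbb R)$ let $u^\varphi$ be the bounded continuous viscosity solution on $[0,\infty)\times\mathbb R$ of the $G$-heat equation $$\partial_tu-G(\partial_x^2u)=0\ \text{ on }(0,\infty)\times\mathbb R,\qquad u(0,x)=\varphi(x),$$ and set $N_G[\varphi]:=u^\varphi(1,0)$. The functionals $N_G$, $G\in\mathcal G^0$, on $C_{b,Lip}(\mathbb R)$ are called $G$-normal distributions. For $G_1,G_2\in\mathcal G^0$ the convolution of $N_{G_1}$ and $N_{G_2}$ is $N_{G_1}*N_{G_2}[\varphi]:=N_{G_1}[\phi]$ with $\phi(x):=N_{G_2}[\varphi(x+\cdot)]$. Theorem. Let $G_1,G_2\in\mathcal G^0$ be non-degenerate, i.e. $\underline\sigma_{G_1}>0$ and $\underline\sigma_{G_2}>0$. Then $N_{G_1}*N_{G_2}$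 is a $G$-normal distribution, i.e. there is $G\in\mathcal G^0$ with $N_{G_1}*N_{G_2}[\varphi]=N_G[\varphi]$ for all $\varphi\in C_{b,Lip}(\mathbb R)$, if and only if $$\beta_{G_1}:=\frac{\overline\sigma_{G_1}}{\underline\sigma_{G_1}}=\frac{\overline\sigma_{G_2}}{\underline\sigma_{G_2}}=:\beta_{G_2}.$$ -/

import Mathlib

open Filter Topology

/-- The parameters `0 ≤ σ_low ≤ σ_up < ∞` of a function
`G(a) = (σ_up² a⁺ - σ_low² a⁻) / 2`; these functions form the class `𝒢⁰`. -/
structure GFunction where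
  low : ℝ
  up : ℝ
  low_nonneg : 0 ≤ low
  low_le_up : low ≤ up

namespace GFunction

/-- `G(a) = (σ_up² a⁺ - σ_low² a⁻) / 2`. -/
noncomputable def eval (G : GFunction) (a : ℝ) : ℝ :=
  (G.up ^ 2 * max a 0 - G.low ^ 2 * max (-a) 0) / 2

/-- `G` is non-degenerate (it lies in `𝒢`) if `σ_low > 0`. -/
def NonDegenerate (G : GFunction) : Prop :=
  0 < G.low

/-- The ratio `β_G = σ_up / σ_low`, meaningful for non-degenerate `G`. -/
noncomputable def beta (G : GFunction) : ℝ :=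
  G.up / G.low

end GFunction

/-- Bounded Lipschitz functions on `ℝ`, the class `C_{b,Lip}(ℝ)`. -/
def BoundedLipschitz (φ : ℝ → ℝ) : Prop :=
  (∃ C : ℝ, ∀ x, |φ x| ≤ C) ∧ ∃ K : NNReal, LipschitzWith K φ

/-- `u` is a viscosity subsolution of `∂ₜu - G(∂ₓ²u) = 0` on `(0,∞) × ℝ`: whenever `u - ψ` has a
local maximum at `(t, x)`, `t > 0`, and `ψ` is `C²` near `(t, x)`,
then `∂ₜψ - G(∂ₓ²ψ) ≤ 0` at `(t, x)`. -/
def IsViscositySubsolution (G : GFunction) (u : ℝ → ℝ → ℝ) : Prop :=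
  ∀ (ψ : ℝ × ℝ → ℝ) (t x : ℝ), 0 < t → ContDiffAt ℝ 2 ψ (t, x) →
    IsLocalMax (fun p : ℝ × ℝ => u p.1 p.2 - ψ p) (t, x) →
      deriv (fun s => ψ (s, x)) t - G.eval (iteratedDeriv 2 (fun y => ψ (t, y)) x) ≤ 0

/-- `u` is a viscosity supersolution of `∂ₜu - G(∂ₓ²u) = 0` on `(0,∞) × ℝ`. -/
def IsViscositySupersolution (G : GFunction) (u : ℝ → ℝ → ℝ) : Prop :=
  ∀ (ψ : ℝ × ℝ → ℝ) (t x : ℝ), 0 < t → ContDiffAt ℝ 2 ψ (t, x) →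
    IsLocalMin (fun p : ℝ × ℝ => u p.1 p.2 - ψ p) (t, x) →
      0 ≤ deriv (fun s => ψ (s, x)) t - G.eval (iteratedDeriv 2 (fun y => ψ (t, y)) x)

/-- `u` is a (bounded, continuous) viscosity solution on `[0,∞) × ℝ` of the `G`-heat equation
`∂ₜu - G(∂ₓ²u) = 0`, `u(0, ·) = φ`. The values of `u` at negative times are irrelevant. -/
structure IsViscositySolution (G : GFunction) (φ : ℝ → ℝ) (u : ℝ → ℝ → ℝ) : Prop where
  continuousOn : ContinuousOn (fun p : ℝ × ℝ => u p.1 p.2) {p | 0 ≤ p.1}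
  bounded : ∃ C : ℝ, ∀ t x, 0 ≤ t → |u t x| ≤ C
  initial : ∀ x, u 0 x = φ x
  subsolution : IsViscositySubsolution G u
  supersolution : IsViscositySupersolution G u

open Classical in
/-- The `G`-normal distribution `N_G[φ] = u^φ(1, 0)`, where `u^φ` is the viscosity solution of the
`G`-heat equation with initial value `φ`. It is meant for bounded Lipschitz `φ`, for which `u^φ`
exists and is unique; the value is `0` if there is no solution. -/
noncomputable def gNormal (G : GFunction) (φ : ℝ → ℝ) : ℝ :=
  if h : ∃ u : ℝ → ℝ → ℝ, IsViscositySolution G φ u then h.choose 1 0 else 0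

/-- The convolution `(N₁ * N₂)[φ] = N₁[x ↦ N₂[φ(x + ·)]]` of functionals on functions on `ℝ`. -/
def functionalConv (N₁ N₂ : (ℝ → ℝ) → ℝ) (φ : ℝ → ℝ) : ℝ :=
  N₁ (fun x => N₂ (fun y => φ (x + y)))

/-- A functional is a `G`-normal distribution if it agrees on `C_{b,Lip}(ℝ)` with `N_G` for some
`G ∈ 𝒢⁰`. -/
def IsGNormal (N : (ℝ → ℝ) → ℝ) : Prop :=
  ∃ G : GFunction, ∀ φ : ℝ → ℝ, BoundedLipschitz φ → N φ = gNormal G φ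

/-! If the ratios agree, then `G₂ = lam • G₁` for some `lam > 0`, so the `G₂`-flow is the `G₁`-flow
run at speed `lam`. By the semigroup property the convolution is the `G₁`-flow at time `1 + lam`,
which is the flow of `(1 + lam) • G₁` at time `1`.

Conversely, suppose that the convolution is `N_G`. Let `p` be the periodic eigenfunction with
`G₂(p'') = -p / 2`, made of positive cosine arcs of width `π σ_low` and negative ones of width `π
σ_up`. The `G₂`-flow only multiplies `p` by `exp(-t / 2)`. Testing on dilates and translates of `p`
gives `u(t, x) = exp(-t / 2) v(t, x)`, where `u` and `v` are the `G`- and `G₁`-flows of `p`. Since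
`v` is bounded, `u` decays to zero. Let `q` be the corresponding eigenfunction of `G₁` with the same
period. If the ratios differ, the arcs of `p` and `q` have different widths, and one profile lies
above the other by a constant `k > 0` (`IsPeriodicProfile.exists_add_le_of_low_lt`). The flow of `q`
dies out, so comparison for `G₁` keeps `v` at distance `k / 2` from zero, with constant sign, at
some time `T`. Then `u(T, ·)` is bounded away from zero with constant sign, and comparison with
constants for `G` preserves this forever, against the decay.

Both directions rest on comparison and existence for the `G`-heat equation. Comparison uses the
convexity of `G`: minus a supersolution is a subsolution of the two linear heat equations with
`σ_low` and `σ_up`, hence lies below its Gaussian means. Mollification keeps this, so a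
supersolution is a locally uniform limit of smooth supersolutions, against which a viscosity
subsolution can be tested directly. No doubling of variables is needed. Existence comes from the
limit of a monotone binomial scheme. -/

open MeasureTheory ProbabilityTheory

/-! ### Viscosity subsolutions for a general nonlinearity -/

/-- `u` is a viscosity subsolution of `∂ₜu - Γ(∂ₓ²u) = 0` on `(0,∞) × ℝ`. -/
def IsViscSub (Γ : ℝ → ℝ) (u : ℝ → ℝ → ℝ) : Prop :=
  ∀ (ψ : ℝ × ℝ → ℝ) (t x : ℝ), 0 < t → ContDiffAt ℝ 2 ψ (t, x) →
    IsLocalMax (fun p : ℝ × ℝ => u p.1 p.2 - ψ p) (t, x) →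
      deriv (fun s => ψ (s, x)) t - Γ (iteratedDeriv 2 (fun y => ψ (t, y)) x) ≤ 0

lemma iteratedDeriv_two_eq (f : ℝ → ℝ) : iteratedDeriv 2 f = deriv (deriv f) := by
  rw [iteratedDeriv_succ, iteratedDeriv_one]

lemma IsViscositySubsolution.isViscSub {G : GFunction} {u : ℝ → ℝ → ℝ}
    (h : IsViscositySubsolution G u) : IsViscSub G.eval u := h

/-- Together with the converse below, this lets one theory of subsolutions serve both halves of the
definition; hence the arbitrary `Γ` in `IsViscSub`. -/
lemma IsViscositySupersolution.isViscSub_neg {G : GFunction} {u : ℝ → ℝ → ℝ}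
    (h : IsViscositySupersolution G u) :
    IsViscSub (fun a => -G.eval (-a)) (fun t x => -u t x) := by
  intro ψ t x ht hψ hmax
  have h1 := h (fun p => -ψ p) t x ht hψ.neg (by
    have := hmax.neg
    refine this.congr (Eventually.of_forall fun p => ?_)
    simp only; ring)
  have e1 : deriv (fun s => -ψ (s, x)) t = -deriv (fun s => ψ (s, x)) t := deriv.fun_neg
  have e2 : iteratedDeriv 2 (fun y => -ψ (t, y)) x = -iteratedDeriv 2 (fun y => ψ (t, y)) x :=
    iteratedDeriv_fun_neg 2 _ x
  simp only [e1, e2] at h1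
  simp only
  linarith

lemma IsViscSub.supersolution {G : GFunction} {u : ℝ → ℝ → ℝ}
    (h : IsViscSub (fun a => -G.eval (-a)) (fun t x => -u t x)) : IsViscositySupersolution G u := by
  intro ψ t x ht hψ hmin
  have h1 := h (fun p => -ψ p) t x ht hψ.neg (by
    have := hmin.neg
    refine this.congr (Eventually.of_forall fun p => ?_)
    simp only; ring)
  have e1 : deriv (fun s => -ψ (s, x)) t = -deriv (fun s => ψ (s, x)) t := deriv.fun_neg
  have e2 : iteratedDeriv 2 (fun y => -ψ (t, y)) x = -iteratedDeriv 2 (fun y => ψ (t, y)) x :=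
    iteratedDeriv_fun_neg 2 _ x
  simp only [e1, e2, neg_neg] at h1
  linarith

lemma contDiff_snd_section {w : ℝ × ℝ → ℝ} {n : WithTop ℕ∞} (hw : ContDiff ℝ n w) (t : ℝ) :
    ContDiff ℝ n (fun y => w (t, y)) := hw.comp (contDiff_prodMk_right t)

lemma contDiff_fst_section {w : ℝ × ℝ → ℝ} {n : WithTop ℕ∞} (hw : ContDiff ℝ n w) (x : ℝ) :
    ContDiff ℝ n (fun s => w (s, x)) := hw.comp (contDiff_prodMk_left x)

/-! ### Comparison with smooth supersolutions -/

/-- Comparison of a viscosity subsolution with a smooth strict supersolution on a box. -/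
lemma IsViscSub.le_of_strict {Γ : ℝ → ℝ} {v : ℝ → ℝ → ℝ} {w : ℝ × ℝ → ℝ} {T R : ℝ}
    (hv : IsViscSub Γ v) (hvc : ContinuousOn (fun p : ℝ × ℝ => v p.1 p.2) {p | 0 ≤ p.1})
    (hw : ContDiff ℝ 2 w)
    (hstrict : ∀ t x, 0 < t →
      Γ (iteratedDeriv 2 (fun y => w (t, y)) x) < deriv (fun s => w (s, x)) t)
    (hinit : ∀ x, |x| ≤ R → v 0 x ≤ w (0, x))
    (hside : ∀ t x, 0 ≤ t → |x| = R → v t x ≤ w (t, x))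
    {t x : ℝ} (ht : 0 ≤ t) (htT : t < T) (hx : |x| ≤ R) : v t x ≤ w (t, x) := by
  by_contra hlt
  push Not at hlt
  set K : Set (ℝ × ℝ) := Set.Icc 0 T ×ˢ Set.Icc (-R) R with hK
  have hKc : IsCompact K := isCompact_Icc.prod isCompact_Icc
  have hKsub : K ⊆ {p : ℝ × ℝ | 0 ≤ p.1} := fun p hp => hp.1.1
  have hmem : (t, x) ∈ K := ⟨⟨ht, htT.le⟩, abs_le.1 hx⟩
  have hcont : ContinuousOn (fun p : ℝ × ℝ => v p.1 p.2 - w p) K :=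
    (hvc.mono hKsub).sub hw.continuous.continuousOn
  obtain ⟨B, hB⟩ := (hKc.bddAbove_image hcont)
  have hB' : ∀ p ∈ K, v p.1 p.2 - w p ≤ B := fun p hp => hB ⟨p, hp, rfl⟩
  set d := v t x - w (t, x) with hd
  have hdpos : 0 < d := by rw [hd]; linarith
  have hdB : d ≤ B := hB' _ hmem
  have hTt : 0 < T - t := by linarith
  -- the penalty
  have hBpos : 0 < B := hdpos.trans_le hdB
  obtain ⟨lam, hlam0, hlam⟩ : ∃ lam : ℝ, 0 < lam ∧ B < d / 2 * Real.exp (lam * (T - t)) := by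
    refine ⟨2 * B / d / (T - t), by positivity, ?_⟩
    have h1 : 2 * B / d / (T - t) * (T - t) = 2 * B / d := by field_simp
    rw [h1]
    have h2 := Real.add_one_le_exp (2 * B / d)
    have h3 : d / 2 * (2 * B / d + 1) = B + d / 2 := by field_simp
    nlinarith
  -- The penalty is `d / 2` at time `t`, leaving a positive excess at `(t, x)`, and exceeds `B` at
  -- time `T`, so the maximum of `v - ψ` cannot sit on the final time slice. It increases in time
  -- and does not depend on `x`, so `ψ` is still a strict supersolution.
  set ψ : ℝ × ℝ → ℝ := fun p => w p + d / 2 * Real.exp (lam * (p.1 - t)) with hψ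
  have hψc : ContDiff ℝ 2 ψ := by
    rw [hψ]; fun_prop
  have hcont2 : ContinuousOn (fun p : ℝ × ℝ => v p.1 p.2 - ψ p) K :=
    (hvc.mono hKsub).sub hψc.continuous.continuousOn
  obtain ⟨p, hpK, hpmax⟩ := hKc.exists_isMaxOn ⟨_, hmem⟩ hcont2
  have hpval : d / 2 ≤ v p.1 p.2 - ψ p := by
    have := hpmax hmem
    simp only [Set.mem_ofPred_eq, hψ, sub_self, mul_zero, Real.exp_zero] at this
    simp only [hψ]
    linarith
  have hpw : d / 2 * Real.exp (lam * (p.1 - t)) < v p.1 p.2 - w p := by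
    simp only [hψ] at hpval; linarith
  have hexp : 0 < d / 2 * Real.exp (lam * (p.1 - t)) := by positivity
  obtain ⟨⟨hp0, hpT⟩, hpR⟩ := hpK
  have hpabs : |p.2| ≤ R := abs_le.2 hpR
  have hp0' : 0 < p.1 := by
    rcases hp0.lt_or_eq with h | h
    · exact h
    · have := hinit p.2 hpabs
      have e : p = (0, p.2) := by rw [h]
      rw [e] at hpw hexp
      simp only at hpw hexp
      linarith
  have hpT' : p.1 < T := by
    rcases hpT.lt_or_eq with h | h
    · exact h
    · have := hB' p ⟨⟨hp0, hpT⟩, hpR⟩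
      rw [h] at hpw
      rw [h] at this
      linarith
  have hpR' : |p.2| < R := by
    rcases hpabs.lt_or_eq with h | h
    · exact h
    · have : v p.1 p.2 ≤ w p := hside p.1 p.2 hp0 h
      linarith
  have hnhds : K ∈ 𝓝 (p.1, p.2) := by
    rw [hK]
    exact prod_mem_nhds (Icc_mem_nhds hp0' hpT') (Icc_mem_nhds (abs_lt.1 hpR').1 (abs_lt.1 hpR').2)
  have hloc : IsLocalMax (fun p : ℝ × ℝ => v p.1 p.2 - ψ p) (p.1, p.2) :=
    hpmax.isLocalMax hnhds
  have key := hv ψ p.1 p.2 hp0' hψc.contDiffAt hloc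
  have hs := hstrict p.1 p.2 hp0'
  have e2 : iteratedDeriv 2 (fun y => ψ (p.1, y)) p.2 =
      iteratedDeriv 2 (fun y => w (p.1, y)) p.2 := by
    rw [iteratedDeriv_two_eq, iteratedDeriv_two_eq]
    congr 1
    funext y
    simp only [hψ]
    exact deriv_add_const _
  have e1 : deriv (fun s => ψ (s, p.2)) p.1 = deriv (fun s => w (s, p.2)) p.1 +
      d / 2 * (Real.exp (lam * (p.1 - t)) * lam) := by
    simp only [hψ]
    have h1 : HasDerivAt (fun s => w (s, p.2)) (deriv (fun s => w (s, p.2)) p.1) p.1 :=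
      ((contDiff_fst_section hw p.2).differentiable (by norm_num)).differentiableAt.hasDerivAt
    have h2 : HasDerivAt (fun s : ℝ => lam * (s - t)) lam p.1 := by
      simpa using ((hasDerivAt_id p.1).sub_const t).const_mul lam
    exact (h1.add (h2.exp.const_mul (d / 2))).deriv
  rw [e1, e2] at key
  have : 0 < d / 2 * (Real.exp (lam * (p.1 - t)) * lam) := by positivity
  linarith

/-- Comparison of a bounded viscosity subsolution with a bounded classical supersolution, when the
initial values are only comparable on a large interval. -/
lemma IsViscSub.le_add {Γ : ℝ → ℝ} {v : ℝ → ℝ → ℝ} {w : ℝ × ℝ → ℝ} {R B C ε δ : ℝ}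
    (hΓ : ∀ a b, 0 ≤ b → Γ (a + b) ≤ Γ a + C * b)
    (hv : IsViscSub Γ v) (hvc : ContinuousOn (fun p : ℝ × ℝ => v p.1 p.2) {p | 0 ≤ p.1})
    (hvB : ∀ t x, 0 ≤ t → |v t x| ≤ B) (hwB : ∀ t x, 0 ≤ t → |w (t, x)| ≤ B)
    (hw : ContDiff ℝ 2 w)
    (hsuper : ∀ t x, 0 < t →
      Γ (iteratedDeriv 2 (fun y => w (t, y)) x) ≤ deriv (fun s => w (s, x)) t)
    (hC : 0 ≤ C) (hε : 0 ≤ ε) (hδ : 0 < δ) (hR0 : 0 ≤ R)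
    (hR : 2 * B ≤ δ * R ^ 2)
    (hinit : ∀ x, |x| ≤ R → v 0 x ≤ w (0, x) + ε)
    {t x : ℝ} (ht : 0 ≤ t) : v t x ≤ w (t, x) + ε + δ * (x ^ 2 + (2 * C + 1) * t) := by
  have hout : ∀ t x, 0 ≤ t → R ^ 2 ≤ x ^ 2 →
      v t x ≤ w (t, x) + ε + δ * (x ^ 2 + (2 * C + 1) * t) := by
    intro t x ht hx
    have h1 := (abs_le.1 (hvB t x ht)).2
    have h2 := (abs_le.1 (hwB t x ht)).1
    have h3 : δ * R ^ 2 ≤ δ * x ^ 2 := by gcongr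
    have h4 : 0 ≤ δ * ((2 * C + 1) * t) := by positivity
    linarith
  rcases le_total (R ^ 2) (x ^ 2) with hx | hx
  · exact hout t x ht hx
  -- The parabola can raise `Γ` by at most `2 * C * δ`, while its time derivative is `δ * (2 * C +
  -- 1)`: the surplus `δ` makes `W` strict. For `|x| ≥ R` the parabola alone exceeds `2 * B`.
  set W : ℝ × ℝ → ℝ := fun p => w p + (ε + δ * (p.2 ^ 2 + (2 * C + 1) * p.1)) with hW
  have key : v t x ≤ W (t, x) := by
    refine IsViscSub.le_of_strict (T := t + 1) (R := R) hv hvc (w := W) ?_ ?_ ?_ ?_ ht (by linarith)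
      (abs_le_of_sq_le_sq hx hR0)
    · rw [hW]; fun_prop
    · intro t x ht
      have e1 : deriv (fun s => W (s, x)) t = deriv (fun s => w (s, x)) t + δ * (2 * C + 1) := by
        have h1 : HasDerivAt (fun s => w (s, x)) (deriv (fun s => w (s, x)) t) t :=
          ((contDiff_fst_section hw x).differentiable (by norm_num)).differentiableAt.hasDerivAt
        have h2 : HasDerivAt (fun s : ℝ => ε + δ * (x ^ 2 + (2 * C + 1) * s))
            (δ * (2 * C + 1)) t := by
          simpa using ((((hasDerivAt_id t).const_mul (2 * C + 1)).const_add (x ^ 2)).const_mul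
            δ).const_add ε
        exact (h1.add h2).deriv
      have e2 : iteratedDeriv 2 (fun y => W (t, y)) x =
          iteratedDeriv 2 (fun y => w (t, y)) x + 2 * δ := by
        have hc := contDiff_snd_section hw t
        have hd : deriv (fun y => W (t, y)) = fun y => deriv (fun y => w (t, y)) y + δ * (2 * y) := by
          funext y
          have h1 : HasDerivAt (fun y => w (t, y)) (deriv (fun y => w (t, y)) y) y :=
            (hc.differentiable (by norm_num)).differentiableAt.hasDerivAt
          have h2 : HasDerivAt (fun y : ℝ => ε + δ * (y ^ 2 + (2 * C + 1) * t))
              (δ * (2 * y)) y := by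
            simpa using (((hasDerivAt_pow 2 y).add_const ((2 * C + 1) * t)).const_mul
              δ).const_add ε
          exact (h1.add h2).deriv
        rw [iteratedDeriv_two_eq, iteratedDeriv_two_eq, hd]
        have h1 : HasDerivAt (deriv (fun y => w (t, y))) (deriv (deriv (fun y => w (t, y))) x) x :=
          ((contDiff_succ_iff_deriv.1 (show ContDiff ℝ (1 + 1) _ from hc)).2.2.differentiable
            (by norm_num)).differentiableAt.hasDerivAt
        have h2 : HasDerivAt (fun y : ℝ => δ * (2 * y)) (2 * δ) x := by
          simpa [mul_comm] using ((hasDerivAt_id x).const_mul 2).const_mul δ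
        exact (h1.add h2).deriv
      rw [e1, e2]
      have := hΓ (iteratedDeriv 2 (fun y => w (t, y)) x) (2 * δ) (by positivity)
      have := hsuper t x ht
      linarith
    · intro x hx
      have := hinit x hx
      have h4 : 0 ≤ δ * x ^ 2 := by positivity
      simp only [hW]
      linarith
    · intro t x ht hx
      have := hout t x ht (by rw [← hx, sq_abs])
      simp only [hW]
      linarith
  simp only [hW] at key
  linarith

/-! ### Affine changes of variables -/

/-- Test functions are pulled back along the inverse affine map. The substitution multiplies `∂ₜ` by
`c * lam` and `∂ₓ²` by `c * ω ^ 2`, and `hΓ` is the resulting compatibility. -/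
lemma IsViscSub.comp_affine {Γ Γ' : ℝ → ℝ} {u : ℝ → ℝ → ℝ} (hu : IsViscSub Γ u)
    {c lam ω t₀ x₀ : ℝ} (hc : 0 < c) (hlam : 0 < lam) (hω : 0 < ω) (ht₀ : 0 ≤ t₀)
    (hΓ : ∀ a, Γ' (c * ω ^ 2 * a) = c * lam * Γ a) :
    IsViscSub Γ' (fun t x => c * u (lam * t + t₀) (ω * x + x₀)) := by
  intro ψ t x ht hψ hmax
  set e : ℝ × ℝ → ℝ × ℝ := fun p => (lam⁻¹ * p.1 + -(lam⁻¹ * t₀), ω⁻¹ * p.2 + -(ω⁻¹ * x₀)) with he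
  have hec : ContDiff ℝ 2 e := by rw [he]; fun_prop
  have hep : e (lam * t + t₀, ω * x + x₀) = (t, x) := by
    simp only [he]; ext <;> simp only <;> field_simp <;> ring
  have hmax' := hu (fun p => c⁻¹ * ψ (e p)) (lam * t + t₀) (ω * x + x₀) (by positivity)
    (contDiffAt_const.mul (ContDiffAt.comp _ (by rw [hep]; exact hψ) hec.contDiffAt)) (by
      have ht : Tendsto e (𝓝 (lam * t + t₀, ω * x + x₀)) (𝓝 (t, x)) := by
        rw [← hep]; exact hec.continuous.tendsto _
      filter_upwards [ht.eventually hmax] with p hp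
      have h1 : lam * (lam⁻¹ * p.1 + -(lam⁻¹ * t₀)) + t₀ = p.1 := by field_simp; ring
      have h2 : ω * (ω⁻¹ * p.2 + -(ω⁻¹ * x₀)) + x₀ = p.2 := by field_simp; ring
      rw [hep]
      have h3 := mul_le_mul_of_nonneg_left hp (inv_nonneg.2 hc.le)
      simp only [he, h1, h2, mul_sub, inv_mul_cancel_left₀ hc.ne'] at h3
      exact h3)
  have e1 : deriv (fun s => c⁻¹ * ψ (e (s, ω * x + x₀))) (lam * t + t₀) =
      c⁻¹ * (lam⁻¹ * deriv (fun s => ψ (s, x)) t) := by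
    have hx : ω⁻¹ * (ω * x + x₀) + -(ω⁻¹ * x₀) = x := by field_simp; ring
    have ht : lam⁻¹ * (lam * t + t₀) + -(lam⁻¹ * t₀) = t := by field_simp; ring
    rw [deriv_const_mul_field']
    simp only [he, hx]
    have := deriv_comp_mul_left lam⁻¹ (fun s => ψ (s + -(lam⁻¹ * t₀), x)) (lam * t + t₀)
    rw [this, deriv_comp_add_const (fun s => ψ (s, x)), ht, smul_eq_mul]
  have e2 : iteratedDeriv 2 (fun y => c⁻¹ * ψ (e (lam * t + t₀, y))) (ω * x + x₀) =
      c⁻¹ * (ω⁻¹ ^ 2 * iteratedDeriv 2 (fun y => ψ (t, y)) x) := by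
    have hx : ω⁻¹ * (ω * x + x₀) + -(ω⁻¹ * x₀) = x := by field_simp; ring
    have ht : lam⁻¹ * (lam * t + t₀) + -(lam⁻¹ * t₀) = t := by field_simp; ring
    have key : ∀ f : ℝ → ℝ, deriv (fun y => f (ω⁻¹ * y + -(ω⁻¹ * x₀))) =
        fun y => ω⁻¹ * deriv f (ω⁻¹ * y + -(ω⁻¹ * x₀)) := by
      intro f
      funext y
      have := deriv_comp_mul_left ω⁻¹ (fun y => f (y + -(ω⁻¹ * x₀))) y
      rw [this, deriv_comp_add_const, smul_eq_mul]
    simp only [he, ht]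
    rw [iteratedDeriv_two_eq, iteratedDeriv_two_eq]
    have h1 : deriv (fun y => c⁻¹ * ψ (t, ω⁻¹ * y + -(ω⁻¹ * x₀))) =
        fun y => c⁻¹ * (ω⁻¹ * deriv (fun y => ψ (t, y)) (ω⁻¹ * y + -(ω⁻¹ * x₀))) := by
      funext y
      rw [deriv_const_mul_field', key (fun y => ψ (t, y))]
    rw [h1, deriv_const_mul_field', deriv_const_mul_field', key (deriv fun y => ψ (t, y))]
    simp only [hx]
    ring
  rw [e1, e2] at hmax'
  set A := iteratedDeriv 2 (fun y => ψ (t, y)) x with hA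
  have h4 := hΓ (c⁻¹ * (ω⁻¹ ^ 2 * A))
  have h5 : c * ω ^ 2 * (c⁻¹ * (ω⁻¹ ^ 2 * A)) = A := by field_simp
  rw [h5] at h4
  have h6 : deriv (fun s => ψ (s, x)) t =
      c * lam * (c⁻¹ * (lam⁻¹ * deriv (fun s => ψ (s, x)) t)) := by field_simp
  rw [h4, h6, ← mul_sub]
  exact mul_nonpos_of_nonneg_of_nonpos (by positivity) hmax'

lemma IsViscSub.shift {Γ : ℝ → ℝ} {u : ℝ → ℝ → ℝ} (hu : IsViscSub Γ u) {t₀ : ℝ} (ht₀ : 0 ≤ t₀) :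
    IsViscSub Γ (fun t x => u (t₀ + t) x) := by
  have := hu.comp_affine (Γ' := Γ) one_pos one_pos one_pos ht₀ (x₀ := 0) (by simp)
  simpa [add_comm] using this


/-! ### Linear heat equations and Gaussian means -/

/-- A Fourier mode of frequency `ω` evolves by the factor `exp(-σ² ω² t / 2)`, which is the Gaussian
characteristic function at `ω σ √t`; the rest is linearity. Trigonometric data are used because
their evolution is smooth on the whole plane, as comparison with smooth functions demands. -/
lemma exists_heat_extension {T : ℝ} [Fact (0 < T)] (σ : ℝ) (q : C(AddCircle T, ℂ))
    (hq : q ∈ Submodule.span ℂ (Set.range (@fourier T))) :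
    ∃ W W₁ W₂ : ℝ × ℝ → ℂ, ContDiff ℝ 2 W ∧
      (∀ t x, HasDerivAt (fun s => W (s, x)) ((σ ^ 2 / 2 : ℝ) * W₂ (t, x)) t) ∧
      (∀ t x, HasDerivAt (fun y => W (t, y)) (W₁ (t, x)) x) ∧
      (∀ t x, HasDerivAt (fun y => W₁ (t, y)) (W₂ (t, x)) x) ∧
      ∀ t x : ℝ, 0 ≤ t → W (t, x) =
        ∫ z, q ((x + σ * √t * z : ℝ) : AddCircle T) ∂(gaussianReal 0 1) := by
  induction hq using Submodule.span_induction with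
  | mem q hq =>
    obtain ⟨n, rfl⟩ := hq
    set ω : ℝ := 2 * Real.pi * n / T with hω
    set W : ℝ × ℝ → ℂ := fun p =>
      Complex.exp (Complex.I * ω * p.2 - (σ ^ 2 / 2 : ℝ) * ω ^ 2 * p.1) with hW
    have hd2 : ∀ t x : ℝ, HasDerivAt (fun y : ℝ => W (t, y)) (Complex.I * ω * W (t, x)) x := by
      intro t x
      have h1 : HasDerivAt (fun y : ℝ => Complex.I * ω * (y : ℂ) - (σ ^ 2 / 2 : ℝ) * ω ^ 2 * t)
          (Complex.I * ω) x := by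
        simpa using ((Complex.ofRealCLM.hasDerivAt (x := x)).const_mul (Complex.I * ω)).sub_const
          ((σ ^ 2 / 2 : ℝ) * ω ^ 2 * t : ℂ)
      exact h1.cexp.congr_deriv (mul_comm _ _)
    refine ⟨W, fun p => Complex.I * ω * W p, fun p => Complex.I * ω * (Complex.I * ω * W p),
      ?_, ?_, hd2, ?_, ?_⟩
    · have h1 : ContDiff ℝ 2 (fun p : ℝ × ℝ => ((p.1 : ℝ) : ℂ)) :=
        Complex.ofRealCLM.contDiff.comp contDiff_fst
      have h2 : ContDiff ℝ 2 (fun p : ℝ × ℝ => ((p.2 : ℝ) : ℂ)) :=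
        Complex.ofRealCLM.contDiff.comp contDiff_snd
      exact ((contDiff_const.mul h2).sub (contDiff_const.mul h1)).cexp
    · intro t x
      have h1 : HasDerivAt (fun s : ℝ => Complex.I * ω * (x : ℂ) - (σ ^ 2 / 2 : ℝ) * ω ^ 2 * s)
          (-((σ ^ 2 / 2 : ℝ) * ω ^ 2)) t := by
        exact (((Complex.ofRealCLM.hasDerivAt (x := t)).const_mul
          ((σ ^ 2 / 2 : ℝ) * ω ^ 2 : ℂ)).const_sub (Complex.I * ω * (x : ℂ))).congr_deriv (by simp)
      have h2 := h1.cexp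
      refine h2.congr_deriv ?_
      simp only [hW]
      linear_combination -(Complex.exp (Complex.I * ω * x - (σ ^ 2 / 2 : ℝ) * ω ^ 2 * t) *
        ((σ ^ 2 / 2 : ℝ) * ω ^ 2)) * Complex.I_sq
    · intro t x
      exact (hd2 t x).const_mul _
    · intro t x ht
      have h1 : ∀ z : ℝ, fourier n ((x + σ * √t * z : ℝ) : AddCircle T) =
          Complex.exp (Complex.I * ω * x) * Complex.exp ((ω * σ * √t : ℝ) * z * Complex.I) := by
        intro z
        rw [fourier_coe_apply, ← Complex.exp_add]
        congr 1
        simp only [hω]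
        push_cast
        ring
      simp_rw [h1]
      rw [integral_const_mul]
      have h2 := charFun_gaussianReal (μ := 0) (v := 1) (ω * σ * √t)
      rw [charFun_apply_real] at h2
      rw [h2, ← Complex.exp_add]
      simp only [hW]
      congr 1
      have h3 : ((√t : ℝ) : ℂ) ^ 2 = t := by
        rw [← Complex.ofReal_pow, Real.sq_sqrt ht]
      push_cast
      linear_combination ((ω ^ 2 * σ ^ 2 / 2) : ℂ) * h3
  | zero =>
    refine ⟨0, 0, 0, contDiff_const, ?_, ?_, ?_, ?_⟩ <;> intros <;> simp [hasDerivAt_const]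
  | add q r _ _ hq hr =>
    obtain ⟨W, W₁, W₂, h1, h2, h3, h4, h5⟩ := hq
    obtain ⟨V, V₁, V₂, g1, g2, g3, g4, g5⟩ := hr
    refine ⟨W + V, W₁ + V₁, W₂ + V₂, h1.add g1, ?_, fun t x => (h3 t x).add (g3 t x),
      fun t x => (h4 t x).add (g4 t x), ?_⟩
    · intro t x
      refine ((h2 t x).add (g2 t x)).congr_deriv ?_
      simp only [Pi.add_apply]; ring
    · intro t x ht
      have hi : ∀ f : C(AddCircle T, ℂ), Integrable
          (fun z => f ((x + σ * √t * z : ℝ) : AddCircle T)) (gaussianReal 0 1) := by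
        intro f
        refine Integrable.of_bound (C := ‖f‖) (Continuous.aestronglyMeasurable ?_)
          (ae_of_all _ fun z => f.norm_coe_le_norm _)
        exact f.continuous.comp ((AddCircle.continuous_mk' T).comp (by fun_prop))
      simp only [Pi.add_apply, ContinuousMap.add_apply]
      rw [integral_add (hi q) (hi r), h5 t x ht, g5 t x ht]
  | smul a q _ hq =>
    obtain ⟨W, W₁, W₂, h1, h2, h3, h4, h5⟩ := hq
    refine ⟨a • W, a • W₁, a • W₂, contDiff_const.smul h1, ?_, fun t x => (h3 t x).const_smul a,
      fun t x => (h4 t x).const_smul a, ?_⟩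
    · intro t x
      refine ((h2 t x).const_smul a).congr_deriv ?_
      simp only [Pi.smul_apply, smul_eq_mul]; ring
    · intro t x ht
      simp only [Pi.smul_apply, ContinuousMap.smul_apply, smul_eq_mul]
      rw [integral_const_mul, h5 t x ht]

/-- The triangle wave `tri` has period `4 * R` and is the identity on `[-R, R]`, so `f ∘ tri` is a
periodic continuous function that agrees with `f` there and keeps its bound. Density of
trigonometric polynomials does the rest. -/
lemma exists_trig_approx {f : ℝ → ℝ} {C R ε : ℝ} (hf : Continuous f) (hC : ∀ x, |f x| ≤ C)
    (hR : 0 < R) (hε : 0 < ε) :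
    ∃ T : ℝ, 0 < T ∧ ∃ q : C(AddCircle T, ℂ), q ∈ Submodule.span ℂ (Set.range (@fourier T)) ∧
      (∀ x : ℝ, |x| ≤ R → |(q (x : AddCircle T)).re - f x| ≤ ε) ∧
      ∀ x : ℝ, |(q (x : AddCircle T)).re| ≤ C + ε := by
  set T := 4 * R with hT
  have hTpos : 0 < T := by positivity
  have : Fact (0 < T) := ⟨hTpos⟩
  set tri : ℝ → ℝ := fun x => 2 * R / Real.pi * Real.arcsin (Real.sin (Real.pi / (2 * R) * x)) with htri
  have hper : Function.Periodic (fun x => (f (tri x) : ℂ)) T := by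
    intro x
    simp only [htri]
    have : Real.pi / (2 * R) * (x + T) = Real.pi / (2 * R) * x + 2 * Real.pi := by
      rw [hT]; field_simp; ring
    rw [this, Real.sin_add_two_pi]
  have hcont : Continuous (fun x => (f (tri x) : ℂ)) := by
    have : Continuous tri := by
      have := Real.continuous_arcsin
      rw [htri]; fun_prop
    fun_prop
  have hlc : Continuous hper.lift := continuous_coinduced_dom.2 hcont
  set g : C(AddCircle T, ℂ) := ⟨hper.lift, hlc⟩ with hg
  have hmem : g ∈ (Submodule.span ℂ (Set.range (@fourier T))).topologicalClosure := by
    rw [span_fourier_closure_eq_top]; trivial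
  obtain ⟨q, hq, hqd⟩ := Metric.mem_closure_iff.1 hmem ε hε
  have hclose : ∀ x : ℝ, |(q (x : AddCircle T)).re - f (tri x)| ≤ ε := by
    intro x
    have h1 : dist (g (x : AddCircle T)) (q x) < ε := (ContinuousMap.dist_apply_le_dist _).trans_lt hqd
    have h2 : g (x : AddCircle T) = (f (tri x) : ℂ) := hper.lift_coe x
    rw [h2, dist_comm, dist_eq_norm] at h1
    have h3 := Complex.abs_re_le_norm (q (x : AddCircle T) - (f (tri x) : ℂ))
    simp only [Complex.sub_re, Complex.ofReal_re] at h3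
    linarith
  refine ⟨T, hTpos, q, hq, ?_, ?_⟩
  · intro x hx
    have h1 : tri x = x := by
      have hx' := abs_le.1 hx
      have hpi := Real.pi_pos
      simp only [htri]
      rw [Real.arcsin_sin]
      · field_simp
      · have : Real.pi / (2 * R) * x + Real.pi / 2 = Real.pi / (2 * R) * (x + R) := by
          field_simp
        have h2 : 0 ≤ Real.pi / (2 * R) * (x + R) :=
          mul_nonneg (by positivity) (by linarith)
        linarith
      · have : Real.pi / 2 - Real.pi / (2 * R) * x = Real.pi / (2 * R) * (R - x) := by
          field_simp
        have h2 : 0 ≤ Real.pi / (2 * R) * (R - x) :=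
          mul_nonneg (by positivity) (by linarith)
        linarith
    have := hclose x
    rwa [h1] at this
  · intro x
    have h1 := hclose x
    have h2 := hC (tri x)
    rw [abs_le] at *
    constructor <;> linarith

lemma le_of_forall_le_add_mul {a b K : ℝ} (h : ∀ ε, 0 < ε → ε ≤ 1 → a ≤ b + ε * K) : a ≤ b := by
  have h1 : Tendsto (fun ε : ℝ => b + ε * K) (𝓝[>] 0) (𝓝 (b + 0 * K)) :=
    ((continuous_const.add (continuous_id.mul continuous_const)).tendsto 0).mono_left
      nhdsWithin_le_nhds
  rw [zero_mul, add_zero] at h1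
  refine ge_of_tendsto h1 ?_
  filter_upwards [Ioc_mem_nhdsGT (zero_lt_one' ℝ)] with ε hε using h ε hε.1 hε.2

lemma integrable_comp_gaussian {f : ℝ → ℝ} {B : ℝ} (hf : Continuous f) (hB : ∀ x, |f x| ≤ B)
    (x τ : ℝ) : Integrable (fun z => f (x + τ * z)) (gaussianReal 0 1) :=
  Integrable.of_bound (C := B) (Continuous.aestronglyMeasurable (by fun_prop))
    (ae_of_all _ fun _ => hB _)

lemma integrable_pow_gaussian (n : ℕ) : Integrable (fun z : ℝ => z ^ n) (gaussianReal 0 1) := by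
  have h := (memLp_id_gaussianReal (μ := 0) (v := 1) (n : NNReal)).integrable_norm_pow'
  refine (integrable_norm_iff (by fun_prop)).1 ?_
  simpa using h

lemma integral_sq_gaussian : ∫ z : ℝ, z ^ 2 ∂(gaussianReal 0 1) = 1 := by
  have h := variance_of_integral_eq_zero (μ := gaussianReal 0 1) (X := fun z : ℝ => z)
    (by fun_prop) integral_id_gaussianReal
  rw [variance_fun_id_gaussianReal] at h
  simpa using h.symm

/-- A polynomial upper bound integrates to an upper bound for the Gaussian mean. -/
lemma integral_gaussian_le {f : ℝ → ℝ} {B : ℝ} (hf : Continuous f) (hB : ∀ x, |f x| ≤ B)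
    {x τ a b c d : ℝ} (h : ∀ z, f (x + z) ≤ a + b * z + c * z ^ 2 + d * z ^ 4) :
    ∫ z, f (x + τ * z) ∂(gaussianReal 0 1) ≤
      a + c * τ ^ 2 + d * τ ^ 4 * ∫ z, z ^ 4 ∂(gaussianReal 0 1) := by
  have i1 : Integrable (fun z : ℝ => z) (gaussianReal 0 1) := by
    simpa using integrable_pow_gaussian 1
  have i2 := integrable_pow_gaussian 2
  have i4 := integrable_pow_gaussian 4
  have j1 : Integrable (fun _ : ℝ => a) (gaussianReal 0 1) := integrable_const a
  have j2 : Integrable (fun z => a + b * τ * z) (gaussianReal 0 1) := j1.add (i1.const_mul _)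
  have j3 : Integrable (fun z => a + b * τ * z + c * τ ^ 2 * z ^ 2) (gaussianReal 0 1) :=
    j2.add (i2.const_mul _)
  calc ∫ z, f (x + τ * z) ∂(gaussianReal 0 1)
      ≤ ∫ z, (a + b * τ * z + c * τ ^ 2 * z ^ 2 + d * τ ^ 4 * z ^ 4) ∂(gaussianReal 0 1) := by
        refine integral_mono (integrable_comp_gaussian hf hB x τ) (j3.add (i4.const_mul _))
          fun z => (h (τ * z)).trans_eq (by ring)
    _ = _ := by
        rw [integral_add j3 (i4.const_mul _), integral_add j2 (i2.const_mul _),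
          integral_add j1 (i1.const_mul _), integral_const_mul, integral_const_mul,
          integral_const_mul, integral_sq_gaussian, integral_id_gaussianReal]
        simp

/-- The function is the real part of the heat extension of a trigonometric approximation of `f`. The
approximation error is at most `ε` on `[-R, R]` and `2 * C + ε` elsewhere, hence at most `ε + (2 * C
+ ε) / R ^ 2 * z ^ 2` everywhere; the last bound is the Gaussian mean of this parabola. -/
lemma exists_heat_approx {f : ℝ → ℝ} {C R ε : ℝ} (σ : ℝ) (hf : Continuous f)
    (hC : ∀ x, |f x| ≤ C) (hR : 0 < R) (hε : 0 < ε) :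
    ∃ w : ℝ × ℝ → ℝ, ContDiff ℝ 2 w ∧
      (∀ t x, deriv (fun s => w (s, x)) t = σ ^ 2 / 2 * iteratedDeriv 2 (fun y => w (t, y)) x) ∧
      (∀ t x, 0 ≤ t → |w (t, x)| ≤ C + ε) ∧ (∀ x, |x| ≤ R → |w (0, x) - f x| ≤ ε) ∧
      ∀ t x, 0 ≤ t → w (t, x) ≤ ∫ z, f (x + σ * √t * z) ∂(gaussianReal 0 1) + ε +
        (2 * C + ε) / R ^ 2 * (x ^ 2 + σ ^ 2 * t) := by
  obtain ⟨T, hT, q, hq, hq1, hq2⟩ := exists_trig_approx hf hC hR hε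
  have : Fact (0 < T) := ⟨hT⟩
  obtain ⟨W, W₁, W₂, h1, h2, h3, h4, h5⟩ := exists_heat_extension σ q hq
  set Q : ℝ → ℝ := fun x => (q (x : AddCircle T)).re with hQ
  have hQc : Continuous Q :=
    Complex.continuous_re.comp (q.continuous.comp (AddCircle.continuous_mk' T))
  have hre : ∀ t x, 0 ≤ t → (W (t, x)).re = ∫ z, Q (x + σ * √t * z) ∂(gaussianReal 0 1) := by
    intro t x ht
    rw [h5 t x ht]
    refine (Complex.reCLM.integral_comp_comm ?_).symm
    refine Integrable.of_bound (C := ‖q‖) (Continuous.aestronglyMeasurable ?_)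
      (ae_of_all _ fun z => q.norm_coe_le_norm _)
    exact q.continuous.comp ((AddCircle.continuous_mk' T).comp (by fun_prop))
  have hC0 : 0 ≤ C := (abs_nonneg _).trans (hC 0)
  refine ⟨fun p => (W p).re, Complex.reCLM.contDiff.comp h1, ?_, ?_, ?_, ?_⟩
  · intro t x
    have e0 : deriv (fun y => (W (t, y)).re) = fun y => (W₁ (t, y)).re := by
      funext y
      exact (Complex.reCLM.hasFDerivAt.comp_hasDerivAt y (h3 t y)).deriv
    rw [iteratedDeriv_two_eq, e0]
    have e1 : HasDerivAt (fun s => (W (s, x)).re) (σ ^ 2 / 2 * (W₂ (t, x)).re) t :=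
      (Complex.reCLM.hasFDerivAt.comp_hasDerivAt t (h2 t x)).congr_deriv
        (by rw [Complex.reCLM_apply, Complex.re_ofReal_mul])
    have e2 : HasDerivAt (fun y => (W₁ (t, y)).re) (W₂ (t, x)).re x :=
      Complex.reCLM.hasFDerivAt.comp_hasDerivAt x (h4 t x)
    exact e1.deriv.trans (by rw [e2.deriv])
  · intro t x ht
    simp only
    rw [hre t x ht]
    have := norm_integral_le_of_norm_le_const (μ := gaussianReal 0 1)
      (f := fun z => Q (x + σ * √t * z)) (C := C + ε) (ae_of_all _ fun z => hq2 (x + σ * √t * z))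
    simpa using this
  · intro x hx
    have := hre 0 x le_rfl
    simp only [Real.sqrt_zero, mul_zero, zero_mul, add_zero, integral_const, probReal_univ,
      one_smul] at this
    simp only [this]
    exact hq1 x hx
  · intro t x ht
    simp only
    rw [hre t x ht]
    set K := (2 * C + ε) / R ^ 2 with hK
    have hK0 : 0 ≤ K := by positivity
    have hb : ∀ z, Q z - f z ≤ ε + K * z ^ 2 := by
      intro z
      rcases le_total |z| R with hz | hz
      · have := (abs_le.1 (hq1 z hz)).2
        have : 0 ≤ K * z ^ 2 := by positivity
        simp only [hQ] at *
        linarith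
      · have h6 := (abs_le.1 (hq2 z)).2
        have h7 := (abs_le.1 (hC z)).1
        have h8 : R ^ 2 ≤ z ^ 2 := by rw [← sq_abs z]; gcongr
        have h9 : K * R ^ 2 ≤ K * z ^ 2 := by gcongr
        have h10 : K * R ^ 2 = 2 * C + ε := by rw [hK]; field_simp
        simp only [hQ] at *
        linarith
    have hsub := integral_gaussian_le (f := fun z => Q z - f z) (B := C + ε + C)
      (hQc.sub hf) (fun z => (abs_sub _ _).trans (add_le_add (hq2 z) (hC z)))
      (x := x) (τ := σ * √t) (a := ε + K * x ^ 2) (b := 2 * K * x) (c := K) (d := 0)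
      (fun z => (hb (x + z)).trans_eq (by ring))
    rw [integral_sub (integrable_comp_gaussian hQc hq2 _ _)
      (integrable_comp_gaussian hf hC _ _), mul_pow, Real.sq_sqrt ht] at hsub
    linarith

/-- A viscosity subsolution of a heat equation lies below the Gaussian means of its initial
values. -/
lemma IsViscSub.le_integral_gaussian_zero {σ B : ℝ} {v : ℝ → ℝ → ℝ}
    (hv : IsViscSub (fun a => σ ^ 2 / 2 * a) v)
    (hvc : ContinuousOn (fun p : ℝ × ℝ => v p.1 p.2) {p | 0 ≤ p.1})
    (hB : ∀ t x, 0 ≤ t → |v t x| ≤ B) {t : ℝ} (ht : 0 ≤ t) (x : ℝ) :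
    v t x ≤ ∫ z, v 0 (x + σ * √t * z) ∂(gaussianReal 0 1) := by
  have hB0 : 0 ≤ B := (abs_nonneg _).trans (hB 0 0 le_rfl)
  have hf : Continuous (v 0) := by
    have := hvc.comp_continuous (f := fun x : ℝ => ((0 : ℝ), x)) (by fun_prop)
      (fun x => le_refl (0 : ℝ))
    exact this
  refine le_of_forall_le_add_mul (K := 2 + (x ^ 2 + (σ ^ 2 + 1) * t) + (x ^ 2 + σ ^ 2 * t)) ?_
  intro ε hε hε1
  -- With `ε * R ^ 2 = 2 * (B + 1)` the barrier with `δ = ε` dominates both functions outside `[-R,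
  -- R]`, and the tail coefficient `(2 * B + ε) / R ^ 2` is at most `ε`.
  set R := √(2 * (B + 1) / ε) with hR
  have hRpos : 0 < R := by rw [hR]; positivity
  have hRsq : R ^ 2 = 2 * (B + 1) / ε := Real.sq_sqrt (by positivity)
  obtain ⟨w, h1, h2, h3, h4, h5⟩ := exists_heat_approx σ hf (fun x => hB 0 x le_rfl) hRpos hε
  have h6 := hv.le_add (w := w) (R := R) (B := B + 1) (C := σ ^ 2 / 2) (ε := ε) (δ := ε)
    (fun a b _ => by rw [mul_add]) hvc (fun t x ht => (hB t x ht).trans (by linarith))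
    (fun t x ht => (h3 t x ht).trans (by linarith)) h1 (fun t x _ => (h2 t x).ge) (by positivity)
    hε.le hε hRpos.le (by rw [hRsq]; field_simp; rfl) (fun x hx => by
      have := (abs_le.1 (h4 x hx)).1
      linarith) (x := x) ht
  have h7 := h5 t x ht
  have h8 : (2 * B + ε) / R ^ 2 ≤ ε := by
    rw [hRsq, div_div_eq_mul_div, div_le_iff₀ (by positivity)]
    nlinarith
  have h9 : (2 * B + ε) / R ^ 2 * (x ^ 2 + σ ^ 2 * t) ≤ ε * (x ^ 2 + σ ^ 2 * t) := by gcongr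
  linarith

lemma IsViscSub.le_integral_gaussian {σ B : ℝ} {v : ℝ → ℝ → ℝ}
    (hv : IsViscSub (fun a => σ ^ 2 / 2 * a) v)
    (hvc : ContinuousOn (fun p : ℝ × ℝ => v p.1 p.2) {p | 0 ≤ p.1})
    (hB : ∀ t x, 0 ≤ t → |v t x| ≤ B) {t s : ℝ} (ht : 0 ≤ t) (hs : 0 ≤ s) (x : ℝ) :
    v (t + s) x ≤ ∫ z, v t (x + σ * √s * z) ∂(gaussianReal 0 1) := by
  have h := (hv.shift ht).le_integral_gaussian_zero (B := B)
    (hvc.comp (f := fun p : ℝ × ℝ => (t + p.1, p.2)) (by fun_prop)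
      (fun p hp => add_nonneg ht hp)) (fun s x hs => hB _ _ (by positivity)) hs x
  simpa using h

/-- A smooth bounded function that lies below its Gaussian means is a classical subsolution of the
heat equation. -/
lemma deriv_le_of_le_integral_gaussian {V : ℝ × ℝ → ℝ} {B σ t x : ℝ} (hV : ContDiff ℝ 2 V)
    (hB : ∀ p, |V p| ≤ B)
    (h : ∀ s, 0 ≤ s → V (t + s, x) ≤ ∫ z, V (t, x + σ * √s * z) ∂(gaussianReal 0 1)) :
    deriv (fun s => V (s, x)) t ≤ σ ^ 2 / 2 * iteratedDeriv 2 (fun y => V (t, y)) x := by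
  set f : ℝ → ℝ := fun y => V (t, y) with hf
  have hfc : ContDiff ℝ 2 f := contDiff_snd_section hV t
  have hfB : ∀ y, |f y| ≤ B := fun y => hB _
  have hf1 : ∀ y, HasDerivAt f (deriv f y) y := fun y =>
    (hfc.differentiable (by norm_num)).differentiableAt.hasDerivAt
  have hf2 : HasDerivAt (deriv f) (iteratedDeriv 2 f x) x := by
    rw [iteratedDeriv_two_eq]
    exact ((contDiff_succ_iff_deriv.1 (show ContDiff ℝ (1 + 1) _ from hfc)).2.2.differentiable
            (by norm_num)).differentiableAt.hasDerivAt
  set A := deriv f x with hA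
  set D := iteratedDeriv 2 f x with hD
  refine le_of_forall_le_add_mul (K := σ ^ 2 / 2) fun η hη _ => ?_
  -- a global polynomial upper bound
  obtain ⟨M, hM⟩ : ∃ M, ∀ z, f (x + z) ≤ f x + A * z + (D + η) / 2 * z ^ 2 + M * z ^ 4 := by
    set g : ℝ → ℝ := fun z => f (x + z) - (f x + A * z + (D + η) / 2 * z ^ 2) with hg
    have hg1 : ∀ z, HasDerivAt g (deriv f (x + z) - (A + (D + η) * z)) z := by
      intro z
      have e1 := (hf1 (x + z)).comp_const_add x z
      have e2 := (((hasDerivAt_id z).const_mul A).const_add (f x)).add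
        ((hasDerivAt_pow 2 z).const_mul ((D + η) / 2))
      refine (e1.sub e2).congr_deriv ?_
      simp; ring
    have hgd : deriv g = fun z => deriv f (x + z) - (A + (D + η) * z) := funext fun z => (hg1 z).deriv
    have hg2 : HasDerivAt (deriv g) (-η) 0 := by
      rw [hgd]
      have e1 : HasDerivAt (fun z => deriv f (x + z)) D 0 := by
        have := HasDerivAt.comp_const_add (f := deriv f) (f' := D) x 0 (by simpa using hf2)
        exact this
      have e2 := ((hasDerivAt_id (0 : ℝ)).const_mul (D + η)).const_add A
      refine (e1.sub e2).congr_deriv ?_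
      simp
    -- The slope of `g` at `0` vanishes and its second derivative there is `-η < 0`, so the
    -- quadratic bound holds near `0`.
    have hmax : IsLocalMax g 0 := by
      refine isLocalMax_of_deriv_deriv_neg ?_ ?_ (hg1 0).continuousAt
      · rw [hg2.deriv]; linarith
      · rw [hgd]; simp [hA]
    have hg0 : g 0 = 0 := by simp [hg]
    obtain ⟨r, hr, hball⟩ := Metric.eventually_nhds_iff.1 hmax
    -- For `|z| ≥ r` the three summands let `z ^ 4` absorb the oscillation `2 * B`, the linear term
    -- and the quadratic term. A quartic is harmless: its Gaussian mean is of order `s ^ 2`, which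
    -- vanishes after division by `s`.
    refine ⟨2 * B / r ^ 4 + |A| / r ^ 3 + |(D + η) / 2| / r ^ 2, fun z => ?_⟩
    have hB0 : 0 ≤ B := (abs_nonneg _).trans (hB (0, 0))
    rcases lt_or_ge |z| r with hz | hz
    · have h1 : g z ≤ g 0 := hball (by simpa using hz)
      rw [hg0] at h1
      simp only [hg] at h1
      have : 0 ≤ (2 * B / r ^ 4 + |A| / r ^ 3 + |(D + η) / 2| / r ^ 2) * z ^ 4 := by positivity
      linarith
    · have hz4 : z ^ 4 = |z| ^ 4 := by
        rw [show (4:ℕ) = 2 * 2 from rfl, pow_mul, pow_mul, sq_abs]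
      have k1 : 2 * B ≤ 2 * B / r ^ 4 * z ^ 4 := by
        rw [hz4]
        calc 2 * B = 2 * B / r ^ 4 * r ^ 4 := by field_simp
          _ ≤ _ := by gcongr
      have k2 : -(A * z) ≤ |A| / r ^ 3 * z ^ 4 := by
        rw [hz4]
        calc -(A * z) ≤ |A| * |z| := by rw [← abs_mul]; exact neg_le_abs _
          _ = |A| / r ^ 3 * (r ^ 3 * |z|) := by field_simp
          _ ≤ |A| / r ^ 3 * (|z| ^ 3 * |z|) := by gcongr
          _ = _ := by ring
      have k3 : -((D + η) / 2 * z ^ 2) ≤ |(D + η) / 2| / r ^ 2 * z ^ 4 := by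
        rw [hz4]
        calc -((D + η) / 2 * z ^ 2) ≤ |(D + η) / 2| * |z| ^ 2 := by
              rw [sq_abs, ← neg_mul]; gcongr; exact neg_le_abs _
          _ = |(D + η) / 2| / r ^ 2 * (r ^ 2 * |z| ^ 2) := by field_simp
          _ ≤ |(D + η) / 2| / r ^ 2 * (|z| ^ 2 * |z| ^ 2) := by gcongr
          _ = _ := by ring
      have k4 := (abs_le.1 (hfB (x + z))).2
      have k5 := (abs_le.1 (hfB x)).1
      rw [add_mul, add_mul]
      linarith
  set m4 := ∫ z, z ^ 4 ∂(gaussianReal 0 1) with hm4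
  have hstep : ∀ s, 0 < s → s⁻¹ * (V (t + s, x) - V (t, x)) ≤
      (D + η) / 2 * σ ^ 2 + M * σ ^ 4 * m4 * s := by
    intro s hs
    have h1 := h s hs.le
    have h2 := integral_gaussian_le hfc.continuous hfB (τ := σ * √s) hM
    have h3 : (σ * √s) ^ 2 = σ ^ 2 * s := by rw [mul_pow, Real.sq_sqrt hs.le]
    have h4 : (σ * √s) ^ 4 = σ ^ 4 * s ^ 2 := by
      rw [show (4:ℕ) = 2 * 2 from rfl, pow_mul, h3]; ring
    rw [h3, h4, ← hm4] at h2
    have h5 : V (t + s, x) - V (t, x) ≤ s * ((D + η) / 2 * σ ^ 2 + M * σ ^ 4 * m4 * s) := by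
      have h6 : V (t, x) = f x := rfl
      have h7 : V (t + s, x) ≤ f x + (D + η) / 2 * (σ ^ 2 * s) + M * (σ ^ 4 * s ^ 2) * m4 :=
        h1.trans h2
      rw [h6]
      calc V (t + s, x) - f x ≤ (D + η) / 2 * (σ ^ 2 * s) + M * (σ ^ 4 * s ^ 2) * m4 := by linarith
        _ = _ := by ring
    rwa [inv_mul_le_iff₀ hs]
  have hd : HasDerivAt (fun s => V (s, x)) (deriv (fun s => V (s, x)) t) t :=
    ((contDiff_fst_section hV x).differentiable (by norm_num)).differentiableAt.hasDerivAt
  have hlim := hd.tendsto_slope_zero_right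
  have hlim2 : Tendsto (fun s : ℝ => (D + η) / 2 * σ ^ 2 + M * σ ^ 4 * m4 * s) (𝓝[>] 0)
      (𝓝 ((D + η) / 2 * σ ^ 2 + M * σ ^ 4 * m4 * 0)) :=
    (Continuous.tendsto (by fun_prop) 0).mono_left nhdsWithin_le_nhds
  have := le_of_tendsto_of_tendsto hlim hlim2 (by
    filter_upwards [self_mem_nhdsWithin] with s hs using hstep s hs)
  linarith

/-! ### Mollification -/

open scoped Convolution in
/-- Mollification preserves the property to lie below Gaussian means. -/
lemma exists_mollification {U : ℝ × ℝ → ℝ} {B r : ℝ} {S : Set ℝ} (hU : Continuous U)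
    (hB : ∀ p, |U p| ≤ B) (hr : 0 < r)
    (hS : ∀ σ ∈ S, ∀ t x s, 0 ≤ t → 0 ≤ s →
      U (t + s, x) ≤ ∫ z, U (t, x + σ * √s * z) ∂(gaussianReal 0 1)) :
    ∃ V : ℝ × ℝ → ℝ, ContDiff ℝ 2 V ∧ (∀ p, |V p| ≤ B) ∧
      (∀ p e, (∀ q ∈ Metric.ball p r, |U q - U p| ≤ e) → |V p - U p| ≤ e) ∧
      ∀ σ ∈ S, ∀ t x s, r ≤ t → 0 ≤ s →
        V (t + s, x) ≤ ∫ z, V (t, x + σ * √s * z) ∂(gaussianReal 0 1) := by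
  let φ : ContDiffBump (0 : ℝ × ℝ) := ⟨r / 2, r, by positivity, by linarith⟩
  set ρ := φ.normed volume with hρ
  have hρc : Continuous ρ := φ.continuous_normed
  have hρi : Integrable ρ := φ.integrable_normed
  have hρ0 : ∀ p, 0 ≤ ρ p := fun p => φ.nonneg_normed p
  have hρ1 : ∫ p, ρ p = 1 := φ.integral_normed
  set V : ℝ × ℝ → ℝ := ρ ⋆[ContinuousLinearMap.lsmul ℝ ℝ, volume] U with hV
  have hVeq : ∀ p, V p = ∫ q, ρ q * U (p - q) := fun p => rfl
  have hint : ∀ p, Integrable (fun q => ρ q * U (p - q)) := by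
    intro p
    refine hρi.mul_bdd (c := B) (Continuous.aestronglyMeasurable (by fun_prop))
      (ae_of_all _ fun q => hB _)
  refine ⟨V, ?_, ?_, ?_, ?_⟩
  · exact (φ.hasCompactSupport_normed (μ := volume)).contDiff_convolution_left (n := 2)
      (𝕜 := ℝ) (ContinuousLinearMap.lsmul ℝ ℝ) φ.contDiff_normed hU.locallyIntegrable
  · intro p
    rw [hVeq]
    calc |∫ q, ρ q * U (p - q)| ≤ ∫ q, ρ q * B := by
          refine norm_integral_le_of_norm_le (f := fun q => ρ q * U (p - q)) (hρi.mul_const B)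
            (ae_of_all _ fun q => ?_)
          rw [norm_mul, Real.norm_of_nonneg (hρ0 q)]
          exact mul_le_mul_of_nonneg_left (hB _) (hρ0 q)
      _ = B := by rw [integral_mul_const, hρ1, one_mul]
  · intro p e hpe
    exact φ.dist_normed_convolution_le hU.aestronglyMeasurable hpe
  · intro σ hσ t x s ht hs
    -- The kernel is supported in the ball of radius `r`, so for `t ≥ r` only translates to
    -- nonnegative times contribute. Averaging their inequalities and exchanging the integrals gives
    -- the claim.
    have hsupp : ∀ q : ℝ × ℝ, ρ q ≠ 0 → 0 ≤ t - q.1 := by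
      intro q hq
      have : q ∈ Metric.ball (0 : ℝ × ℝ) r := by
        have : q ∈ Function.support ρ := hq
        rwa [hρ, φ.support_normed_eq] at this
      have h1 : ‖q‖ < r := by simpa using this
      have h2 := (norm_fst_le q).trans_lt h1
      have h3 := (abs_lt.1 h2).2
      linarith
    have hint2 : Integrable (fun a : ℝ × (ℝ × ℝ) => ρ a.2 * U (t - a.2.1, x + σ * √s * a.1 - a.2.2))
        ((gaussianReal 0 1).prod volume) := by
      have h1 : Integrable (fun a : ℝ × (ℝ × ℝ) => ρ a.2) ((gaussianReal 0 1).prod volume) :=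
        hρi.comp_snd _
      exact h1.mul_bdd (c := B) (Continuous.aestronglyMeasurable (by fun_prop))
        (ae_of_all _ fun q => hB _)
    calc V (t + s, x) = ∫ q, ρ q * U ((t + s, x) - q) := hVeq _
      _ ≤ ∫ q : ℝ × ℝ, ρ q * ∫ z, U (t - q.1, x + σ * √s * z - q.2) ∂(gaussianReal 0 1) := by
          refine integral_mono (hint _) ?_ fun q => ?_
          · have h2 := hint2.swap.integral_prod_left
            simp only [Function.comp_def, Prod.swap, integral_const_mul] at h2
            exact h2
          · by_cases hq : ρ q = 0
            · simp [hq]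
            · have h1 := hS σ hσ (t - q.1) (x - q.2) s (hsupp q hq) hs
              have e1 : (t + s, x) - q = (t - q.1 + s, x - q.2) := by
                ext
                · simp; ring
                · simp
              simp only
              rw [e1]
              refine mul_le_mul_of_nonneg_left (h1.trans_eq ?_) (hρ0 q)
              congr 1; funext z; congr 2; ring
      _ = ∫ q : ℝ × ℝ, ∫ z, ρ q * U (t - q.1, x + σ * √s * z - q.2) ∂(gaussianReal 0 1) := by
          simp_rw [integral_const_mul]
      _ = ∫ z, (∫ q : ℝ × ℝ, ρ q * U (t - q.1, x + σ * √s * z - q.2)) ∂(gaussianReal 0 1) :=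
          (integral_integral_swap (f := fun z q => ρ q * U (t - q.1, x + σ * √s * z - q.2))
            hint2).symm
      _ = _ := rfl

/-! ### Algebra of `G` as a maximum of two linear functions -/

namespace GFunction

lemma eval_eq_of_nonneg (G : GFunction) {a : ℝ} (ha : 0 ≤ a) : G.eval a = G.up ^ 2 / 2 * a := by
  rw [eval, max_eq_left ha, max_eq_right (by linarith)]; ring

lemma eval_eq_of_nonpos (G : GFunction) {a : ℝ} (ha : a ≤ 0) : G.eval a = G.low ^ 2 / 2 * a := by
  rw [eval, max_eq_right ha, max_eq_left (by linarith)]; ring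

lemma low_sq_le (G : GFunction) : G.low ^ 2 ≤ G.up ^ 2 := by
  have := G.low_nonneg
  have := G.low_le_up
  gcongr

/-- With `up_mul_le_eval` and `eval_eq_or` this says that `G` is the maximum of two linear
functions, the form in which convexity enters both comparison and the scheme. -/
lemma low_mul_le_eval (G : GFunction) (a : ℝ) : G.low ^ 2 / 2 * a ≤ G.eval a := by
  rcases le_total 0 a with ha | ha
  · rw [G.eval_eq_of_nonneg ha]
    have := G.low_sq_le
    gcongr
  · rw [G.eval_eq_of_nonpos ha]

lemma up_mul_le_eval (G : GFunction) (a : ℝ) : G.up ^ 2 / 2 * a ≤ G.eval a := by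
  rcases le_total 0 a with ha | ha
  · rw [G.eval_eq_of_nonneg ha]
  · rw [G.eval_eq_of_nonpos ha]
    have := G.low_sq_le
    exact mul_le_mul_of_nonpos_right (by linarith) ha

lemma eval_eq_or (G : GFunction) (a : ℝ) :
    G.eval a = G.low ^ 2 / 2 * a ∨ G.eval a = G.up ^ 2 / 2 * a := by
  rcases le_total 0 a with ha | ha
  · exact Or.inr (G.eval_eq_of_nonneg ha)
  · exact Or.inl (G.eval_eq_of_nonpos ha)

lemma eval_add_le (G : GFunction) (a b : ℝ) (hb : 0 ≤ b) :
    G.eval (a + b) ≤ G.eval a + G.up ^ 2 / 2 * b := by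
  have h1 := G.low_mul_le_eval a
  have h2 := G.up_mul_le_eval a
  have h3 := mul_le_mul_of_nonneg_right G.low_sq_le hb
  rcases G.eval_eq_or (a + b) with h | h <;> rw [h] <;> linarith

lemma eval_mono (G : GFunction) {a b : ℝ} (h : a ≤ b) : G.eval a ≤ G.eval b := by
  rcases G.eval_eq_or a with h1 | h1
  · rw [h1]
    refine le_trans ?_ (G.low_mul_le_eval b)
    gcongr
  · rw [h1]
    refine le_trans ?_ (G.up_mul_le_eval b)
    gcongr

lemma eval_mul (G : GFunction) {c : ℝ} (hc : 0 ≤ c) (a : ℝ) : G.eval (c * a) = c * G.eval a := by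
  rcases le_total 0 a with ha | ha
  · rw [G.eval_eq_of_nonneg ha, G.eval_eq_of_nonneg (mul_nonneg hc ha)]; ring
  · rw [G.eval_eq_of_nonpos ha, G.eval_eq_of_nonpos (mul_nonpos_of_nonneg_of_nonpos hc ha)]; ring

end GFunction

/-! ### Comparison principle -/

lemma IsViscSub.mono {Γ Γ' : ℝ → ℝ} {u : ℝ → ℝ → ℝ} (hu : IsViscSub Γ u) (h : ∀ a, Γ a ≤ Γ' a) :
    IsViscSub Γ' u := fun ψ t x ht hψ hmax =>
  (sub_le_sub_left (h _) _).trans (hu ψ t x ht hψ hmax)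

/-- A supersolution can be approximated by classical supersolutions, locally uniformly. -/
lemma IsViscositySupersolution.exists_classical_approx {G : GFunction} {u : ℝ → ℝ → ℝ} {B : ℝ}
    (hu : IsViscositySupersolution G u)
    (huc : ContinuousOn (fun p : ℝ × ℝ => u p.1 p.2) {p | 0 ≤ p.1})
    (huB : ∀ t x, 0 ≤ t → |u t x| ≤ B) {T R ε : ℝ} (hε : 0 < ε) :
    ∃ w : ℝ × ℝ → ℝ, ContDiff ℝ 2 w ∧ (∀ p, |w p| ≤ B) ∧
      (∀ t x, 0 < t → G.eval (iteratedDeriv 2 (fun y => w (t, y)) x) ≤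
        deriv (fun s => w (s, x)) t) ∧
      ∀ t x, 0 ≤ t → t ≤ T → |x| ≤ R → |w (t, x) - u t x| ≤ ε := by
  set v : ℝ → ℝ → ℝ := fun t x => -u t x with hv
  have hvs := hu.isViscSub_neg
  have hvc : ContinuousOn (fun p : ℝ × ℝ => v p.1 p.2) {p | 0 ≤ p.1} := huc.neg
  have hvB : ∀ t x, 0 ≤ t → |v t x| ≤ B := fun t x ht => by
    simpa only [hv, abs_neg] using huB t x ht
  have hvS : ∀ σ ∈ ({G.low, G.up} : Set ℝ), IsViscSub (fun a => σ ^ 2 / 2 * a) v := by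
    intro σ hσ
    refine hvs.mono fun a => ?_
    rcases hσ with rfl | rfl
    · have := G.low_mul_le_eval (-a); linarith
    · have := G.up_mul_le_eval (-a); linarith
  -- Freezing `v` at its initial value for negative times gives a continuous function on the whole
  -- plane, which can be mollified.
  set U : ℝ × ℝ → ℝ := fun p => v (max p.1 0) p.2 with hU
  have hUc : Continuous U :=
    hvc.comp_continuous (f := fun p : ℝ × ℝ => (max p.1 0, p.2)) (by fun_prop)
      (fun p => le_max_right p.1 0)
  have hUB : ∀ p, |U p| ≤ B := fun p => hvB _ _ (le_max_right _ _)
  have hUS : ∀ σ ∈ ({G.low, G.up} : Set ℝ), ∀ t x s, 0 ≤ t → 0 ≤ s →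
      U (t + s, x) ≤ ∫ z, U (t, x + σ * √s * z) ∂(gaussianReal 0 1) := by
    intro σ hσ t x s ht hs
    have h := (hvS σ hσ).le_integral_gaussian hvc hvB ht hs x
    simp only [hU, max_eq_left ht, max_eq_left (add_nonneg ht hs)]
    exact h
  -- modulus of continuity
  set K : Set (ℝ × ℝ) := Set.Icc (-3) (T + 3) ×ˢ Set.Icc (-R - 3) (R + 3) with hK
  have hKc : IsCompact K := isCompact_Icc.prod isCompact_Icc
  have hunif := Metric.uniformContinuousOn_iff_le.1
    (hKc.uniformContinuousOn_of_continuous hUc.continuousOn) (ε / 2) (by positivity)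
  obtain ⟨δ, hδ, hmod⟩ := hunif
  set r := min (δ / 2) 1 with hr
  have hr0 : 0 < r := by rw [hr]; positivity
  have hr1 : r ≤ 1 := min_le_right _ _
  have hrδ : r ≤ δ / 2 := min_le_left _ _
  obtain ⟨V, h1, h2, h3, h4⟩ := exists_mollification hUc hUB hr0 hUS
  have hsub : ∀ σ ∈ ({G.low, G.up} : Set ℝ), ∀ t x, r ≤ t →
      deriv (fun s => V (s, x)) t ≤ σ ^ 2 / 2 * iteratedDeriv 2 (fun y => V (t, y)) x :=
    fun σ hσ t x ht => deriv_le_of_le_integral_gaussian h1 h2 fun s hs => h4 σ hσ t x s ht hs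
  -- The Gaussian inequality for `V` is available only from time `r` on; the time shift moves this
  -- region to all `t ≥ 0`. The two linear inequalities combine to the nonlinear one because `G`
  -- always equals one of its two linear branches.
  refine ⟨fun p => -V (p.1 + r, p.2), ?_, ?_, ?_, ?_⟩
  · have : ContDiff ℝ 2 (fun p : ℝ × ℝ => (p.1 + r, p.2)) := by fun_prop
    exact (h1.comp this).neg
  · intro p
    rw [abs_neg]
    exact h2 _
  · intro t x ht
    have e1 : deriv (fun s => -V (s + r, x)) t = -deriv (fun s => V (s, x)) (t + r) := by
      rw [deriv.fun_neg, deriv_comp_add_const (fun s => V (s, x))]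
    have e2 : iteratedDeriv 2 (fun y => -V (t + r, y)) x =
        -iteratedDeriv 2 (fun y => V (t + r, y)) x := iteratedDeriv_fun_neg 2 _ x
    simp only [e1, e2]
    have g1 := hsub G.low (by simp) (t + r) x (by linarith)
    have g2 := hsub G.up (by simp) (t + r) x (by linarith)
    rcases G.eval_eq_or (-iteratedDeriv 2 (fun y => V (t + r, y)) x) with h | h <;> rw [h] <;>
      linarith
  · intro t x ht htT hxR
    have hx := abs_le.1 hxR
    have m1 : (t + r, x) ∈ K := by
      refine ⟨⟨?_, ?_⟩, ?_, ?_⟩ <;> simp only <;> linarith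
    have m0 : (t, x) ∈ K := by
      refine ⟨⟨?_, ?_⟩, ?_, ?_⟩ <;> simp only <;> linarith
    have k1 := h3 (t + r, x) (ε / 2) (by
      intro q hq
      have hq' : ‖q - (t + r, x)‖ < r := by rwa [← dist_eq_norm]
      have q1 := abs_lt.1 ((norm_fst_le _).trans_lt hq')
      have q2 := abs_lt.1 ((norm_snd_le _).trans_lt hq')
      simp only [Prod.fst_sub, Prod.snd_sub] at q1 q2
      refine hmod q ⟨⟨?_, ?_⟩, ?_, ?_⟩ _ m1 ?_
      · linarith
      · linarith
      · linarith
      · linarith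
      · exact (Metric.mem_ball.1 hq).le.trans (by linarith))
    have k2 := hmod _ m1 _ m0 (by
      rw [Prod.dist_eq, Real.dist_eq, Real.dist_eq]
      simp only [add_sub_cancel_left, sub_self, abs_zero, abs_of_pos hr0]
      exact max_le (by linarith) hδ.le)
    rw [Real.dist_eq] at k2
    have k3 : U (t, x) = -u t x := by simp only [hU, max_eq_left ht, hv]
    rw [k3] at k2
    rw [abs_le] at *
    constructor <;> linarith

/-- Comparison principle for the `G`-heat equation. -/
theorem IsViscositySubsolution.le_supersolution {G : GFunction} {v u : ℝ → ℝ → ℝ} {B : ℝ}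
    (hv : IsViscositySubsolution G v) (hu : IsViscositySupersolution G u)
    (hvc : ContinuousOn (fun p : ℝ × ℝ => v p.1 p.2) {p | 0 ≤ p.1})
    (huc : ContinuousOn (fun p : ℝ × ℝ => u p.1 p.2) {p | 0 ≤ p.1})
    (hvB : ∀ t x, 0 ≤ t → |v t x| ≤ B) (huB : ∀ t x, 0 ≤ t → |u t x| ≤ B)
    (hinit : ∀ x, v 0 x ≤ u 0 x) {t : ℝ} (ht : 0 ≤ t) (x : ℝ) : v t x ≤ u t x := by
  have hB0 : 0 ≤ B := (abs_nonneg _).trans (hvB 0 0 le_rfl)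
  refine le_of_forall_le_add_mul (K := 2 + (x ^ 2 + (2 * (G.up ^ 2 / 2) + 1) * t)) fun ε hε _ => ?_
  set R := max |x| √(2 * B / ε) with hR
  have hR0 : 0 ≤ R := (abs_nonneg x).trans (le_max_left _ _)
  have hRsq : 2 * B ≤ ε * R ^ 2 := by
    have h1 : √(2 * B / ε) ^ 2 ≤ R ^ 2 := by gcongr; exact le_max_right _ _
    rw [Real.sq_sqrt (by positivity), div_le_iff₀ hε] at h1
    linarith
  obtain ⟨w, h1, h2, h3, h4⟩ := hu.exists_classical_approx huc huB (T := t) (R := R) hε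
  have h5 := hv.isViscSub.le_add (C := G.up ^ 2 / 2) G.eval_add_le hvc hvB (fun t x _ => h2 (t, x))
    h1 h3 (by positivity) hε.le hε hR0 hRsq (fun y hy => by
      have := (abs_le.1 (h4 0 y le_rfl ht hy)).1
      linarith [hinit y]) (x := x) ht
  have h6 := (abs_le.1 (h4 t x ht le_rfl (le_max_left _ _))).2
  linarith

/-! ### Convergence of monotone schemes -/

/-- Replaces an exact maximum point for the scheme, whose values are only piecewise constant in time
and need not attain their supremum. -/
lemma exists_forall_le_add {α : Type*} {s : Set α} {F : α → ℝ} {M e : ℝ} (hs : s.Nonempty)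
    (hM : ∀ p ∈ s, F p ≤ M) (he : 0 < e) : ∃ p ∈ s, ∀ q ∈ s, F q ≤ F p + e := by
  have hb : BddAbove (F '' s) := ⟨M, by rintro _ ⟨p, hp, rfl⟩; exact hM p hp⟩
  obtain ⟨_, ⟨p, hp, rfl⟩, h⟩ := exists_lt_of_lt_csSup (hs.image F) (sub_lt_self (sSup (F '' s)) he)
  refine ⟨p, hp, fun q hq => ?_⟩
  have := le_csSup hb ⟨q, hq, rfl⟩
  linarith

/-- Consistency of the symmetric difference scheme with the heat operator. -/
lemma symmetric_difference_le {ψ : ℝ × ℝ → ℝ} {t₀ x₀ σ c : ℝ} (hψ : ContDiffAt ℝ 2 ψ (t₀, x₀))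
    (hσ : 0 ≤ σ) (hc : 0 < c) :
    ∃ r > 0, ∀ t x k, |t - t₀| < r → |x - x₀| < r → 0 < k → k < r →
      (ψ (t - k ^ 2, x + σ * k) + ψ (t - k ^ 2, x - σ * k)) / 2 ≤ ψ (t, x) +
        k ^ 2 * (σ ^ 2 / 2 * iteratedDeriv 2 (fun y => ψ (t₀, y)) x₀ -
          deriv (fun s => ψ (s, x₀)) t₀ + c) := by
  set g : ℝ × ℝ → ℝ := fun p => fderiv ℝ ψ p (0, 1) with hg
  have hdiff : ∀ᶠ p in 𝓝 (t₀, x₀), DifferentiableAt ℝ ψ p :=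
    (hψ.eventually (by simp)).mono fun p hp => hp.differentiableAt (by norm_num)
  have hx : ∀ p : ℝ × ℝ, DifferentiableAt ℝ ψ p → HasDerivAt (fun y => ψ (p.1, y)) (g p) p.2 := by
    intro p hp
    have h1 : HasDerivAt (fun y : ℝ => (p.1, y)) ((0 : ℝ), (1 : ℝ)) p.2 :=
      (hasDerivAt_const _ _).prodMk (hasDerivAt_id _)
    exact hp.hasFDerivAt.comp_hasDerivAt p.2 h1
  -- Strict differentiability of `ψ` and of `∂ₓψ` bounds differences between any two points near
  -- `(t₀, x₀)`, so the estimate is uniform in the base point.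
  have hstrict1 : HasStrictFDerivAt ψ (fderiv ℝ ψ (t₀, x₀)) (t₀, x₀) :=
    hψ.hasStrictFDerivAt (by norm_num)
  have hτ : deriv (fun s => ψ (s, x₀)) t₀ = fderiv ℝ ψ (t₀, x₀) (1, 0) := by
    have h1 : HasDerivAt (fun y : ℝ => (y, x₀)) ((1 : ℝ), (0 : ℝ)) t₀ :=
      (hasDerivAt_id _).prodMk (hasDerivAt_const _ _)
    exact (hstrict1.hasFDerivAt.comp_hasDerivAt t₀ h1).deriv
  have hfd : ContDiffAt ℝ 1 (fderiv ℝ ψ) (t₀, x₀) := hψ.fderiv_right (by norm_num)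
  have hgc : ContDiffAt ℝ 1 g (t₀, x₀) := hfd.clm_apply contDiffAt_const
  have hstrict2 : HasStrictFDerivAt g (fderiv ℝ g (t₀, x₀)) (t₀, x₀) :=
    hgc.hasStrictFDerivAt (by norm_num)
  have hA : iteratedDeriv 2 (fun y => ψ (t₀, y)) x₀ = fderiv ℝ g (t₀, x₀) (0, 1) := by
    have h1 : HasDerivAt (fun y : ℝ => (t₀, y)) ((0 : ℝ), (1 : ℝ)) x₀ :=
      (hasDerivAt_const _ _).prodMk (hasDerivAt_id _)
    have h2 := hstrict2.hasFDerivAt.comp_hasDerivAt x₀ h1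
    rw [iteratedDeriv_two_eq]
    have h3 : deriv (fun y => ψ (t₀, y)) =ᶠ[𝓝 x₀] fun y => g (t₀, y) := by
      have ht : Tendsto (fun y : ℝ => (t₀, y)) (𝓝 x₀) (𝓝 (t₀, x₀)) :=
        Continuous.tendsto (by fun_prop) x₀
      filter_upwards [ht.eventually hdiff] with y hy using (hx (t₀, y) hy).deriv
    rw [h3.deriv_eq]
    exact h2.deriv
  rw [hτ, hA]
  set τ := fderiv ℝ ψ (t₀, x₀) (1, 0) with hτ'
  set A := fderiv ℝ g (t₀, x₀) (0, 1) with hA'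
  -- The time difference costs `η` and the space difference `η * σ ^ 2 / 2`, in units of `k ^ 2`;
  -- together they give `c`.
  set η := c / (1 + σ ^ 2 / 2) with hη
  have hη0 : 0 < η := by positivity
  have hηc : η * (1 + σ ^ 2 / 2) = c := by rw [hη]; field_simp
  have hs1 := hstrict1.isLittleO.bound hη0
  have hs2 := hstrict2.isLittleO.bound hη0
  have hs2' : ∀ᶠ p : (ℝ × ℝ) × (ℝ × ℝ) in 𝓝 ((t₀, x₀), (t₀, x₀)), DifferentiableAt ℝ ψ p.1 :=
    (Continuous.tendsto continuous_fst ((t₀, x₀), (t₀, x₀))).eventually hdiff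
  obtain ⟨ρ, hρ, hball⟩ := Metric.eventually_nhds_iff.1 (hs1.and (hs2.and hs2'))
  have hclose : ∀ p q : ℝ × ℝ, |p.1 - t₀| < ρ → |p.2 - x₀| < ρ → |q.1 - t₀| < ρ → |q.2 - x₀| < ρ →
      dist (p, q) ((t₀, x₀), (t₀, x₀)) < ρ := by
    intro p q h1 h2 h3 h4
    simp only [Prod.dist_eq, Real.dist_eq]
    exact max_lt (max_lt h1 h2) (max_lt h3 h4)
  refine ⟨min (ρ / (2 * (1 + σ))) (min (ρ / 2) 1), by positivity, ?_⟩
  intro t x k ht hxx hk hkr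
  have hk1 : k < 1 := hkr.trans_le ((min_le_right _ _).trans (min_le_right _ _))
  have hkρ : k < ρ / 2 := hkr.trans_le ((min_le_right _ _).trans (min_le_left _ _))
  have htρ : |t - t₀| < ρ / 2 := ht.trans_le ((min_le_right _ _).trans (min_le_left _ _))
  have hxρ : |x - x₀| < ρ / 2 := hxx.trans_le ((min_le_right _ _).trans (min_le_left _ _))
  have hσk : σ * k < ρ / 2 := by
    have h1 := hkr.trans_le (min_le_left _ _)
    rw [lt_div_iff₀ (by positivity)] at h1
    nlinarith
  have hk2 : k ^ 2 < ρ / 2 := by nlinarith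
  have hk2' : 0 < k ^ 2 := by positivity
  rw [abs_lt] at htρ hxρ
  have ht' : |t - k ^ 2 - t₀| < ρ := by rw [abs_lt]; constructor <;> linarith
  -- time difference
  have step1 : ψ (t - k ^ 2, x) ≤ ψ (t, x) - k ^ 2 * τ + η * k ^ 2 := by
    have h1 := (hball (y := ((t, x), (t - k ^ 2, x))) (hclose _ _
      (by rw [abs_lt]; constructor <;> simp only <;> linarith)
      (by rw [abs_lt]; constructor <;> simp only <;> linarith) ht'
      (by rw [abs_lt]; constructor <;> simp only <;> linarith))).1
    have e1 : ((t, x) : ℝ × ℝ) - (t - k ^ 2, x) = (k ^ 2) • ((1 : ℝ), (0 : ℝ)) := by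
      ext <;> simp
    simp only [e1, map_smul, norm_smul] at h1
    have e2 : ‖((1 : ℝ), (0 : ℝ))‖ = 1 := by simp [Prod.norm_def]
    rw [e2, mul_one, Real.norm_of_nonneg hk2'.le, Real.norm_eq_abs] at h1
    have := (abs_le.1 h1).1
    rw [smul_eq_mul] at this
    linarith
  -- space difference
  have step2 : ψ (t - k ^ 2, x + σ * k) + ψ (t - k ^ 2, x - σ * k) ≤
      2 * ψ (t - k ^ 2, x) + (σ * k) ^ 2 * (A + η) := by
    set h : ℝ → ℝ := fun s => ψ (t - k ^ 2, x + s) + ψ (t - k ^ 2, x - s) - s ^ 2 * (A + η) with hh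
    have hrange : ∀ s ∈ Set.Icc 0 (σ * k), |x + s - x₀| < ρ ∧ |x - s - x₀| < ρ := by
      intro s hs
      rw [abs_lt, abs_lt]
      refine ⟨⟨?_, ?_⟩, ?_, ?_⟩ <;> linarith [hs.1, hs.2]
    have hder : ∀ s ∈ Set.Icc 0 (σ * k), HasDerivAt h
        (g (t - k ^ 2, x + s) - g (t - k ^ 2, x - s) - 2 * s * (A + η)) s := by
      intro s hs
      obtain ⟨hr1, hr2⟩ := hrange s hs
      have d1 := (hball (y := ((t - k ^ 2, x + s), (t - k ^ 2, x + s)))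
        (hclose _ _ ht' hr1 ht' hr1)).2.2
      have d2 := (hball (y := ((t - k ^ 2, x - s), (t - k ^ 2, x - s)))
        (hclose _ _ ht' hr2 ht' hr2)).2.2
      have f1 := (hx _ d1).comp_const_add x s
      have f2 := (hx _ d2).comp_const_sub x s
      have f3 := (hasDerivAt_pow 2 s).mul_const (A + η)
      refine ((f1.add f2).sub f3).congr_deriv ?_
      simp; ring
    -- The derivative of `h` is a first difference of `∂ₓψ` over a distance `2 * s`, minus `2 * s *
    -- (A + η)`, hence nonpositive. Comparing the endpoints bounds the second difference.
    have hanti : AntitoneOn h (Set.Icc 0 (σ * k)) := by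
      refine antitoneOn_of_deriv_nonpos (convex_Icc _ _)
        (fun s hs => (hder s hs).continuousAt.continuousWithinAt)
        (fun s hs => (hder s (interior_subset hs)).differentiableAt.differentiableWithinAt) ?_
      intro s hs
      have hs' := interior_subset hs
      rw [(hder s hs').deriv]
      obtain ⟨hr1, hr2⟩ := hrange s hs'
      have h1 := (hball (y := ((t - k ^ 2, x + s), (t - k ^ 2, x - s)))
        (hclose _ _ ht' hr1 ht' hr2)).2.1
      have e1 : ((t - k ^ 2, x + s) : ℝ × ℝ) - (t - k ^ 2, x - s) =
          (2 * s) • ((0 : ℝ), (1 : ℝ)) := by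
        ext
        · simp
        · simp; ring
      simp only [e1, map_smul, norm_smul] at h1
      have e2 : ‖((0 : ℝ), (1 : ℝ))‖ = 1 := by simp [Prod.norm_def]
      rw [e2, mul_one, Real.norm_of_nonneg (by linarith [hs'.1] : (0 : ℝ) ≤ 2 * s),
        Real.norm_eq_abs] at h1
      have := (abs_le.1 h1).2
      rw [smul_eq_mul] at this
      linarith
    have hσk0 : 0 ≤ σ * k := by positivity
    have := hanti ⟨le_rfl, hσk0⟩ ⟨hσk0, le_rfl⟩ hσk0
    simp only [hh, add_zero, sub_zero] at this
    linarith
  rw [← hηc]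
  linarith

set_option maxHeartbeats 1000000 in
/-- Stability: locally uniform limits of a monotone consistent scheme are viscosity
subsolutions. -/
lemma isViscSub_of_scheme {Γ : ℝ → ℝ} {F : Filter ℕ} [F.NeBot] {k : ℕ → ℝ}
    {v : ℕ → ℝ → ℝ → ℝ} {u : ℝ → ℝ → ℝ} {S : Finset ℝ} (hS : ∀ σ ∈ S, 0 ≤ σ)
    (hk0 : ∀ n, 0 < k n) (hk : Tendsto k F (𝓝 0))
    (hunif : ∀ T R ε, 0 < ε → ∀ᶠ n in F, ∀ t x, 0 ≤ t → t ≤ T → |x| ≤ R → |v n t x - u t x| ≤ ε)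
    (hscheme : ∀ a n t x, k n ^ 2 ≤ t → ∃ σ ∈ S, σ ^ 2 / 2 * a ≤ Γ a ∧
      v n t x ≤ (v n (t - k n ^ 2) (x + σ * k n) + v n (t - k n ^ 2) (x - σ * k n)) / 2) :
    IsViscSub Γ u := by
  intro ψ t₀ x₀ ht₀ hψ hmax
  by_contra! hd
  set A := iteratedDeriv 2 (fun y => ψ (t₀, y)) x₀ with hA
  set τ := deriv (fun s => ψ (s, x₀)) t₀ with hτ
  set d := τ - Γ A with hdd
  -- uniform consistency
  obtain ⟨r₁, hr₁, hcons⟩ : ∃ r > 0, ∀ σ ∈ S, ∀ t x k, |t - t₀| < r → |x - x₀| < r → 0 < k → k < r →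
      (ψ (t - k ^ 2, x + σ * k) + ψ (t - k ^ 2, x - σ * k)) / 2 ≤ ψ (t, x) +
        k ^ 2 * (σ ^ 2 / 2 * A - τ + d / 4) := by
    clear hscheme
    induction S using Finset.induction_on with
    | empty => exact ⟨1, one_pos, by simp⟩
    | insert σ S _ ih =>
      obtain ⟨r, hr, h⟩ := ih fun σ' hσ' => hS σ' (Finset.mem_insert_of_mem hσ')
      obtain ⟨r', hr', h'⟩ := symmetric_difference_le hψ (hS σ (Finset.mem_insert_self _ _))
        (show 0 < d / 4 by linarith)
      refine ⟨min r r', lt_min hr hr', fun σ' hσ' t x k h1 h2 h3 h4 => ?_⟩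
      rcases Finset.mem_insert.1 hσ' with rfl | hσ'
      · exact h' t x k (h1.trans_le (min_le_right _ _)) (h2.trans_le (min_le_right _ _)) h3
          (h4.trans_le (min_le_right _ _))
      · exact h σ' hσ' t x k (h1.trans_le (min_le_left _ _)) (h2.trans_le (min_le_left _ _)) h3
          (h4.trans_le (min_le_left _ _))
  obtain ⟨M, hM0, hM⟩ : ∃ M : ℝ, 0 ≤ M ∧ ∀ σ ∈ S, σ ≤ M := by
    obtain ⟨M, hM⟩ := S.bddAbove
    exact ⟨max M 0, le_max_right _ _, fun σ hσ => (hM hσ).trans (le_max_left _ _)⟩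
  obtain ⟨r₂, hr₂, hloc⟩ := Metric.eventually_nhds_iff.1 hmax
  obtain ⟨r, hr, hrr₁, hrr₂, hrt, hr1⟩ : ∃ r > 0, r < r₁ ∧ r < r₂ ∧ r < t₀ / 2 ∧ r < 1 := by
    refine ⟨min (min r₁ r₂) (min (t₀ / 2) 1) / 2, by positivity, ?_, ?_, ?_, ?_⟩
    all_goals
      refine (half_lt_self (by positivity)).trans_le ?_
      simp
  set m := u t₀ x₀ - ψ (t₀, x₀) with hm
  set Bx : Set (ℝ × ℝ) := {p | |p.1 - t₀| ≤ r ∧ |p.2 - x₀| ≤ r} with hBx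
  have hBmax : ∀ p ∈ Bx, u p.1 p.2 - ψ p ≤ m := by
    intro p hp
    refine hloc ?_
    rw [Prod.dist_eq, Real.dist_eq, Real.dist_eq]
    exact (max_le hp.1 hp.2).trans_lt hrr₂
  -- The penalty `θ * Q` localises the near-maximum, and one step of the scheme raises its average
  -- by at most `h ^ 2 * (d / 4)`.
  set θ := d / (4 * (3 + M ^ 2)) with hθ
  have hθ0 : 0 < θ := by positivity
  have hθd : θ * (3 + M ^ 2) = d / 4 := by rw [hθ]; field_simp
  -- Outside the half-size box the penalty is at least `θ * r ^ 2 / 4`. This beats the two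
  -- approximation errors `2 * κ` and the slack of the near-maximum, which is below `θ * r ^ 2 / 8`.
  set κ := θ * r ^ 2 / 16 with hκ
  have hκ0 : 0 < κ := by positivity
  have ev1 := hunif (t₀ + r) (|x₀| + r) κ hκ0
  have ev2 : ∀ᶠ n in F, k n < min (min (r / 2) (r / (2 * (M + 1)))) (θ * r ^ 2 / (2 * d)) :=
    hk.eventually (gt_mem_nhds (by positivity))
  obtain ⟨n, hn, hkn⟩ := (ev1.and ev2).exists
  set h := k n with hh
  have hpos : 0 < h := hk0 n
  have hh1 : h < r / 2 := hkn.trans_le ((min_le_left _ _).trans (min_le_left _ _))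
  have hh2 : M * h ≤ r / 2 := by
    have := hkn.trans_le ((min_le_left _ _).trans (min_le_right _ _))
    rw [lt_div_iff₀ (by positivity)] at this
    nlinarith
  have hh3 : h ^ 2 * d < θ * r ^ 2 / 2 := by
    have := hkn.trans_le (min_le_right _ _)
    rw [lt_div_iff₀ (by positivity)] at this
    have h3 : h ^ 2 ≤ h := by nlinarith
    nlinarith
  have hhsq : h ^ 2 ≤ h := by nlinarith
  have hhsq0 : 0 < h ^ 2 := by positivity
  have hnB : ∀ p ∈ Bx, |v n p.1 p.2 - u p.1 p.2| ≤ κ := by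
    intro p hp
    have h1 := abs_le.1 hp.1
    refine hn p.1 p.2 (by linarith) (by linarith) ?_
    have h2 := abs_sub_abs_le_abs_sub p.2 x₀
    linarith [hp.2]
  set Q : ℝ × ℝ → ℝ := fun p => (p.1 - t₀) ^ 2 + (p.2 - x₀) ^ 2 with hQ
  set Φ : ℝ × ℝ → ℝ := fun p => v n p.1 p.2 - ψ p - θ * Q p with hΦ
  have hp₀ : (t₀, x₀) ∈ Bx := by simp [hBx, hr.le]
  have hQ0 : ∀ p, 0 ≤ θ * Q p := fun p => by positivity
  have hΦle : ∀ p ∈ Bx, Φ p ≤ m + κ - θ * Q p := by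
    intro p hp
    have h1 := (abs_le.1 (hnB p hp)).2
    have h2 := hBmax p hp
    simp only [hΦ]
    linarith
  obtain ⟨p, hpB, hpmax⟩ := exists_forall_le_add ⟨_, hp₀⟩ (M := m + κ) (F := Φ)
    (fun p hp => (hΦle p hp).trans (by linarith [hQ0 p])) (show 0 < h ^ 2 * (d / 4) by positivity)
  have hinner : |p.1 - t₀| ≤ r / 2 ∧ |p.2 - x₀| ≤ r / 2 := by
    by_contra hcon
    have hQr : r ^ 2 / 4 ≤ Q p := by
      rw [not_and_or, not_le, not_le] at hcon
      have hs : ∀ y : ℝ, r / 2 < |y| → r ^ 2 / 4 ≤ y ^ 2 := by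
        intro y hy
        rw [← sq_abs y]
        nlinarith [abs_nonneg y]
      simp only [hQ]
      rcases hcon with hc | hc
      · have := hs _ hc; nlinarith [sq_nonneg (p.2 - x₀)]
      · have := hs _ hc; nlinarith [sq_nonneg (p.1 - t₀)]
    have h1 := hpmax _ hp₀
    have h2 := hΦle p hpB
    have h3 : m - κ ≤ Φ (t₀, x₀) := by
      have := (abs_le.1 (hnB _ hp₀)).1
      simp only [hΦ, hQ, hm, sub_self] at *
      norm_num
      linarith
    have h4 : θ * (r ^ 2 / 4) ≤ θ * Q p := by gcongr
    linarith
  have hp1 := abs_le.1 hinner.1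
  have hp2 := abs_le.1 hinner.2
  obtain ⟨σ, hσS, hσΓ, hσv⟩ := hscheme A n p.1 p.2 (by
    show h ^ 2 ≤ p.1
    linarith only [hhsq, hh1, hp1.1, hr1, hrt, hr])
  have hσ0 := hS σ hσS
  have hσM := hM σ hσS
  have hσh : σ * h ≤ r / 2 := (mul_le_mul_of_nonneg_right hσM hpos.le).trans hh2
  have hσh0 : 0 ≤ σ * h := by positivity
  have b1 : (p.1 - h ^ 2, p.2 + σ * h) ∈ Bx := by
    constructor <;> rw [abs_le] <;> constructor <;> simp only <;>
      linarith only [hp1.1, hp1.2, hp2.1, hp2.2, hσh, hσh0, hhsq, hhsq0, hh1]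
  have b2 : (p.1 - h ^ 2, p.2 - σ * h) ∈ Bx := by
    constructor <;> rw [abs_le] <;> constructor <;> simp only <;>
      linarith only [hp1.1, hp1.2, hp2.1, hp2.2, hσh, hσh0, hhsq, hhsq0, hh1]
  have c1 := hpmax _ b1
  have c2 := hpmax _ b2
  have hconsp := hcons σ hσS p.1 p.2 h (hinner.1.trans_lt (by linarith only [hr, hrr₁]))
    (hinner.2.trans_lt (by linarith only [hr, hrr₁])) hpos (by linarith only [hr, hrr₁, hh1])
  simp only [hΦ, hQ] at c1 c2
  have hM2 : σ ^ 2 ≤ M ^ 2 := by gcongr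
  have hpen : θ * ((p.1 - h ^ 2 - t₀) ^ 2 + ((p.2 + σ * h - x₀) ^ 2 + (p.2 - σ * h - x₀) ^ 2) / 2) ≤
      θ * ((p.1 - t₀) ^ 2 + (p.2 - x₀) ^ 2) + h ^ 2 * (d / 4) := by
    have h1 : θ * ((p.1 - h ^ 2 - t₀) ^ 2 +
        ((p.2 + σ * h - x₀) ^ 2 + (p.2 - σ * h - x₀) ^ 2) / 2) =
        θ * ((p.1 - t₀) ^ 2 + (p.2 - x₀) ^ 2) +
          h ^ 2 * (θ * (-2 * (p.1 - t₀) + h ^ 2 + σ ^ 2)) := by ring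
    rw [h1, ← hθd]
    have : -2 * (p.1 - t₀) + h ^ 2 + σ ^ 2 ≤ 3 + M ^ 2 := by
      linarith only [hM2, hp1.1, hr1, hhsq, hh1]
    gcongr
  -- In units of `h ^ 2` the gain is `d`, while consistency, penalty and near-maximality cost `d /
  -- 4` each; the surplus `d / 4` is the contradiction.
  have hcoef : h ^ 2 * (σ ^ 2 / 2 * A - τ + d / 4) ≤ h ^ 2 * (-(3 * d / 4)) := by
    refine mul_le_mul_of_nonneg_left ?_ hhsq0.le
    linarith only [hσΓ, hdd]
  have hfin : 0 < h ^ 2 * d := mul_pos hhsq0 hd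
  linarith only [hfin, hcoef, hpen, hconsp, c1, c2, hσv]

/-! ### The binomial scheme: stability and moduli of continuity -/

namespace GFunction

/-- One step of the binomial scheme for the `G`-heat equation, with space step `k`. -/
noncomputable def step (G : GFunction) (k : ℝ) (f : ℝ → ℝ) (x : ℝ) : ℝ :=
  max ((f (x + G.low * k) + f (x - G.low * k)) / 2) ((f (x + G.up * k) + f (x - G.up * k)) / 2)

variable {G : GFunction} {f : ℝ → ℝ} {k : ℝ}

lemma step_lipschitz {K : ℝ} (hf : ∀ x y, |f x - f y| ≤ K * |x - y|) (x y : ℝ) :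
    |G.step k f x - G.step k f y| ≤ K * |x - y| := by
  have key : ∀ a, |(f (x + a) + f (x - a)) / 2 - (f (y + a) + f (y - a)) / 2| ≤ K * |x - y| := by
    intro a
    have h1 := hf (x + a) (y + a)
    have h2 := hf (x - a) (y - a)
    rw [add_sub_add_right_eq_sub] at h1
    rw [sub_sub_sub_cancel_right] at h2
    rw [abs_le] at *
    constructor <;> linarith
  exact (abs_max_sub_max_le_max _ _ _ _).trans (max_le (key _) (key _))

lemma step_bounded {C : ℝ} (hf : ∀ x, |f x| ≤ C) (x : ℝ) : |G.step k f x| ≤ C := by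
  have key : ∀ a, |(f (x + a) + f (x - a)) / 2| ≤ C := by
    intro a
    have h1 := hf (x + a)
    have h2 := hf (x - a)
    rw [abs_le] at *
    constructor <;> linarith
  exact abs_max_le_max_abs_abs.trans (max_le (key _) (key _))

/-- A parabola stays a parabola under averaging and rises by at most `a * G.up ^ 2 * k ^ 2`. Such
parabolas are the barriers that control the scheme in time. -/
lemma step_le_quadratic {a c x₀ : ℝ} (ha : 0 ≤ a) (hf : ∀ x, f x ≤ c + a * (x - x₀) ^ 2) (x : ℝ) :
    G.step k f x ≤ c + a * G.up ^ 2 * k ^ 2 + a * (x - x₀) ^ 2 := by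
  have key : ∀ σ, σ ^ 2 ≤ G.up ^ 2 → (f (x + σ * k) + f (x - σ * k)) / 2 ≤
      c + a * G.up ^ 2 * k ^ 2 + a * (x - x₀) ^ 2 := by
    intro σ hσ
    have h1 := hf (x + σ * k)
    have h2 := hf (x - σ * k)
    have h3 : a * σ ^ 2 * k ^ 2 ≤ a * G.up ^ 2 * k ^ 2 := by gcongr
    nlinarith
  exact max_le (key _ G.low_sq_le) (key _ le_rfl)

lemma quadratic_le_step {a c x₀ : ℝ} (hf : ∀ x, c - a * (x - x₀) ^ 2 ≤ f x) (x : ℝ) :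
    c - a * G.up ^ 2 * k ^ 2 - a * (x - x₀) ^ 2 ≤ G.step k f x := by
  refine le_trans ?_ (le_max_right _ _)
  have h1 := hf (x + G.up * k)
  have h2 := hf (x - G.up * k)
  nlinarith

lemma iterate_step_lipschitz {K : ℝ} (hf : ∀ x y, |f x - f y| ≤ K * |x - y|) (m : ℕ) :
    ∀ x y, |(G.step k)^[m] f x - (G.step k)^[m] f y| ≤ K * |x - y| := by
  induction m with
  | zero => exact hf
  | succ m ih =>
    rw [Function.iterate_succ_apply']
    exact step_lipschitz ih

lemma iterate_step_bounded {C : ℝ} (hf : ∀ x, |f x| ≤ C) (m : ℕ) :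
    ∀ x, |(G.step k)^[m] f x| ≤ C := by
  induction m with
  | zero => exact hf
  | succ m ih =>
    rw [Function.iterate_succ_apply']
    exact step_bounded ih

/-- By `|y| ≤ δ + y ^ 2 / δ`, a Lipschitz function is trapped between two parabolas at `x₀`, which
move at most linearly in the number of steps. Taking `δ` of the order of the square root of the
elapsed time would give Hölder continuity of order `1 / 2`. -/
lemma abs_iterate_step_sub_le {K δ : ℝ} (hK : 0 ≤ K) (hδ : 0 < δ)
    (hf : ∀ x y, |f x - f y| ≤ K * |x - y|) (m : ℕ) (x₀ : ℝ) :
    |(G.step k)^[m] f x₀ - f x₀| ≤ K * (δ + G.up ^ 2 * (m * k ^ 2) / δ) := by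
  have hq : ∀ x, |f x - f x₀| ≤ K * δ + K / δ * (x - x₀) ^ 2 := by
    intro x
    refine (hf x x₀).trans ?_
    have h1 : |x - x₀| ≤ δ + (x - x₀) ^ 2 / δ := by
      rw [← sub_le_iff_le_add', le_div_iff₀ hδ, ← sq_abs (x - x₀)]
      nlinarith [sq_nonneg (|x - x₀| - δ), abs_nonneg (x - x₀)]
    calc K * |x - x₀| ≤ K * (δ + (x - x₀) ^ 2 / δ) := by gcongr
      _ = _ := by ring
  have hub : ∀ m : ℕ, ∀ x, (G.step k)^[m] f x ≤
      (f x₀ + K * δ + m * (K / δ * G.up ^ 2 * k ^ 2)) + K / δ * (x - x₀) ^ 2 := by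
    intro m
    induction m with
    | zero =>
      intro x
      have := (abs_le.1 (hq x)).2
      simp only [Function.iterate_zero, id, Nat.cast_zero, zero_mul, add_zero]
      linarith
    | succ m ih =>
      intro x
      rw [Function.iterate_succ_apply']
      refine (step_le_quadratic (by positivity) ih x).trans_eq ?_
      push_cast; ring
  have hlb : ∀ m : ℕ, ∀ x, (f x₀ - K * δ - m * (K / δ * G.up ^ 2 * k ^ 2)) -
      K / δ * (x - x₀) ^ 2 ≤ (G.step k)^[m] f x := by
    intro m
    induction m with
    | zero =>
      intro x
      have := (abs_le.1 (hq x)).1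
      simp only [Function.iterate_zero, id, Nat.cast_zero, zero_mul, sub_zero]
      linarith
    | succ m ih =>
      intro x
      rw [Function.iterate_succ_apply']
      refine le_trans (le_of_eq ?_) (quadratic_le_step ih x)
      push_cast; ring
  have h1 := hub m x₀
  have h2 := hlb m x₀
  rw [sub_self] at h1 h2
  have h3 : K * (δ + G.up ^ 2 * (m * k ^ 2) / δ) = K * δ + m * (K / δ * G.up ^ 2 * k ^ 2) := by ring
  rw [h3, abs_le]
  constructor <;> linarith

/-- The approximate solution of the `G`-heat equation given by the binomial scheme with space step
`k` and time step `k ^ 2`. -/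
noncomputable def approx (G : GFunction) (φ : ℝ → ℝ) (k t : ℝ) : ℝ → ℝ :=
  (G.step k)^[⌊t / k ^ 2⌋₊] φ

variable {φ : ℝ → ℝ} {K : ℝ}

lemma approx_eq_step (hk : 0 < k) {t : ℝ} (ht : k ^ 2 ≤ t) :
    G.approx φ k t = G.step k (G.approx φ k (t - k ^ 2)) := by
  have h1 : ⌊t / k ^ 2⌋₊ = ⌊(t - k ^ 2) / k ^ 2⌋₊ + 1 := by
    rw [← Nat.floor_add_one (div_nonneg (by linarith) (by positivity))]
    congr 1
    field_simp
    ring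
  rw [approx, h1, Function.iterate_succ_apply', approx]

/-- The later function arises from the earlier one by further steps. Their total duration may exceed
`|t - s|` by one time step through rounding, hence the extra `k ^ 2`. -/
lemma abs_approx_sub_le (hK : 0 ≤ K) (hφ : ∀ x y, |φ x - φ y| ≤ K * |x - y|) (hk : 0 < k)
    {δ t s : ℝ} (hδ : 0 < δ) (ht : 0 ≤ t) (hs : 0 ≤ s) (x y : ℝ) :
    |G.approx φ k t x - G.approx φ k s y| ≤
      K * |x - y| + K * (δ + G.up ^ 2 * (|t - s| + k ^ 2) / δ) := by
  wlog hst : s ≤ t generalizing s t x y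
  · have := this hs ht y x (not_le.1 hst).le
    rwa [abs_sub_comm, abs_sub_comm y, abs_sub_comm s] at this
  have hle : ⌊s / k ^ 2⌋₊ ≤ ⌊t / k ^ 2⌋₊ := Nat.floor_mono (by gcongr)
  obtain ⟨j, hj⟩ := Nat.exists_eq_add_of_le' hle
  have hlip := iterate_step_lipschitz (G := G) (k := k) hφ ⌊s / k ^ 2⌋₊
  have h1 : G.approx φ k t = (G.step k)^[j] (G.approx φ k s) := by
    rw [approx, hj, Function.iterate_add_apply, approx]
  have h2 := abs_iterate_step_sub_le (G := G) (k := k) hK hδ hlip j x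
  have h3 : (j : ℝ) * k ^ 2 ≤ |t - s| + k ^ 2 := by
    have e1 : (j : ℝ) = (⌊t / k ^ 2⌋₊ : ℝ) - ⌊s / k ^ 2⌋₊ := by rw [hj]; push_cast; ring
    have e2 : (⌊t / k ^ 2⌋₊ : ℝ) ≤ t / k ^ 2 := Nat.floor_le (by positivity)
    have e3 := Nat.lt_floor_add_one (s / k ^ 2)
    have e4 : (j : ℝ) ≤ (t - s) / k ^ 2 + 1 := by rw [sub_div]; linarith
    rw [abs_of_nonneg (by linarith)]
    calc (j : ℝ) * k ^ 2 ≤ ((t - s) / k ^ 2 + 1) * k ^ 2 := by gcongr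
      _ = _ := by field_simp
  have h4 : K * (δ + G.up ^ 2 * (j * k ^ 2) / δ) ≤ K * (δ + G.up ^ 2 * (|t - s| + k ^ 2) / δ) := by
    gcongr
  have h5 := hlip x y
  calc |G.approx φ k t x - G.approx φ k s y|
      ≤ |G.approx φ k t x - G.approx φ k s x| + |G.approx φ k s x - G.approx φ k s y| :=
        abs_sub_le _ _ _
    _ ≤ _ := by
      rw [h1, add_comm]
      exact add_le_add h5 (h2.trans h4)

end GFunction

/-! ### Existence of viscosity solutions -/

lemma tendsto_scheme_step : Tendsto (fun n : ℕ => 1 / ((n : ℝ) + 1)) (hyperfilter ℕ : Filter ℕ) (𝓝 0) :=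
  tendsto_one_div_add_atTop_nhds_zero_nat.mono_left
    (Nat.hyperfilter_le_atTop)

/-- Existence of viscosity solutions of the `G`-heat equation for bounded Lipschitz data. -/
theorem exists_isViscositySolution (G : GFunction) {φ : ℝ → ℝ} (hφ : BoundedLipschitz φ) :
    ∃ u, IsViscositySolution G φ u := by
  obtain ⟨⟨C, hC⟩, K, hK⟩ := hφ
  have hφK : ∀ x y, |φ x - φ y| ≤ (K : ℝ) * |x - y| := fun x y => by
    simpa [Real.dist_eq] using hK.dist_le_mul x y
  have hK0 : (0 : ℝ) ≤ K := K.2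
  set k : ℕ → ℝ := fun n => 1 / ((n : ℝ) + 1) with hk
  have hkpos : ∀ n, 0 < k n := fun n => by rw [hk]; positivity
  -- Along an ultrafilter finer than `atTop` the bounded values converge at all points
  -- simultaneously, so no subsequence has to be extracted.
  set F : Filter ℕ := (hyperfilter ℕ : Filter ℕ) with hF
  have hk0 : Tendsto k F (𝓝 0) := tendsto_scheme_step
  set v : ℕ → ℝ → ℝ → ℝ := fun n t x => G.approx φ (k n) t x with hv
  have hvC : ∀ n t x, |v n t x| ≤ C := fun n t x => GFunction.iterate_step_bounded hC _ x
  have hlim : ∀ t x, ∃ l, Tendsto (fun n => v n t x) F (𝓝 l) := by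
    intro t x
    obtain ⟨l, _, hl⟩ := (isCompact_Icc (a := -C) (b := C)).ultrafilter_le_nhds
      ((hyperfilter ℕ).map (fun n => v n t x)) (by
        rw [le_principal_iff]
        exact Ultrafilter.mem_map.2 (Filter.univ_mem' fun n => abs_le.1 (hvC n t x)))
    exact ⟨l, hl⟩
  choose u hu using hlim
  have huC : ∀ t x, |u t x| ≤ C := fun t x =>
    le_of_tendsto (hu t x).abs (Eventually.of_forall fun n => hvC n t x)
  have hmod : ∀ δ t s x y, 0 < δ → 0 ≤ t → 0 ≤ s →
      |u t x - u s y| ≤ K * |x - y| + K * (δ + G.up ^ 2 * |t - s| / δ) := by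
    intro δ t s x y hδ ht hs
    have h1 : Tendsto (fun n => (K : ℝ) * |x - y| +
        K * (δ + G.up ^ 2 * (|t - s| + k n ^ 2) / δ)) F
        (𝓝 (K * |x - y| + K * (δ + G.up ^ 2 * (|t - s| + 0 ^ 2) / δ))) :=
      ((((((hk0.pow 2).const_add _).const_mul _).div_const _).const_add _).const_mul _).const_add _
    rw [zero_pow two_ne_zero, add_zero] at h1
    exact le_of_tendsto_of_tendsto ((hu t x).sub (hu s y)).abs h1
      (Eventually.of_forall fun n => GFunction.abs_approx_sub_le hK0 hφK (hkpos n) hδ ht hs x y)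
  -- a common modulus of continuity
  have hequi : ∀ ε, 0 < ε → ∃ ρ > 0, ∀ᶠ n in F, ∀ t s x y, 0 ≤ t → 0 ≤ s → |t - s| < ρ →
      |x - y| < ρ → |v n t x - v n s y| ≤ ε ∧ |u t x - u s y| ≤ ε := by
    intro ε hε
    set δ := ε / (4 * (K + 1)) with hδ
    have hδ0 : 0 < δ := by positivity
    have hKδ : K * δ ≤ ε / 4 := by
      rw [hδ, mul_div_assoc', div_le_div_iff₀ (by positivity) (by positivity)]
      nlinarith
    set ρ := min (ε / (4 * (K + 1))) (ε * δ / (4 * (K * G.up ^ 2 + 1))) with hρ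
    have hρ0 : 0 < ρ := by positivity
    have hKρ : K * ρ ≤ ε / 4 := (mul_le_mul_of_nonneg_left (min_le_left _ _) hK0).trans hKδ
    have hUρ : K * (G.up ^ 2 * ρ / δ) ≤ ε / 4 := by
      have h1 : ρ ≤ ε * δ / (4 * (K * G.up ^ 2 + 1)) := min_le_right _ _
      rw [le_div_iff₀ (by positivity)] at h1
      rw [mul_div_assoc', div_le_iff₀ hδ0]
      nlinarith
    refine ⟨ρ / 2, by positivity, ?_⟩
    have ev : ∀ᶠ n in F, k n ^ 2 < ρ / 2 := by
      have := hk0.pow 2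
      rw [zero_pow two_ne_zero] at this
      exact this.eventually (gt_mem_nhds (by positivity))
    filter_upwards [ev] with n hn t s x y ht hs hts hxy
    have b1 : (K : ℝ) * |x - y| ≤ ε / 4 := by
      refine (mul_le_mul_of_nonneg_left ?_ hK0).trans hKρ
      linarith
    have b2 : ∀ a, a ≤ ρ → (K : ℝ) * (δ + G.up ^ 2 * a / δ) ≤ ε / 2 := by
      intro a ha
      have : (K : ℝ) * (G.up ^ 2 * a / δ) ≤ K * (G.up ^ 2 * ρ / δ) := by gcongr
      rw [mul_add]
      linarith
    have h1 := GFunction.abs_approx_sub_le (G := G) hK0 hφK (hkpos n) hδ0 ht hs x y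
    have h2 := hmod δ t s x y hδ0 ht hs
    exact ⟨h1.trans (by linarith [b2 (|t - s| + k n ^ 2) (by linarith)]),
      h2.trans (by linarith [b2 |t - s| (by linarith)])⟩
  have hcont : ContinuousOn (fun p : ℝ × ℝ => u p.1 p.2) {p | 0 ≤ p.1} := by
    rw [Metric.continuousOn_iff]
    intro p hp ε hε
    obtain ⟨ρ, hρ, hev⟩ := hequi (ε / 2) (by positivity)
    obtain ⟨n, hn⟩ := hev.exists
    refine ⟨ρ, hρ, fun q hq hqp => ?_⟩
    rw [Prod.dist_eq, max_lt_iff, Real.dist_eq, Real.dist_eq] at hqp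
    rw [Real.dist_eq]
    exact ((hn _ _ _ _ hq hp hqp.1 hqp.2).2).trans_lt (by linarith)
  have hunif : ∀ T R ε, 0 < ε → ∀ᶠ n in F, ∀ t x, 0 ≤ t → t ≤ T → |x| ≤ R →
      |v n t x - u t x| ≤ ε := by
    intro T R ε hε
    obtain ⟨ρ, hρ, hev⟩ := hequi (ε / 3) (by positivity)
    obtain ⟨c, hcK, hcf, hcov⟩ := ((isCompact_Icc (a := (0 : ℝ)) (b := T)).prod
      (isCompact_Icc (a := -R) (b := R))).finite_cover_balls hρ
    have hev2 : ∀ᶠ n in F, ∀ p ∈ c, |v n p.1 p.2 - u p.1 p.2| ≤ ε / 3 := by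
      rw [hcf.eventually_all]
      intro p _
      filter_upwards [(Metric.tendsto_nhds.1 (hu p.1 p.2)) (ε / 3) (by positivity)] with n hn
      rw [Real.dist_eq] at hn
      exact hn.le
    filter_upwards [hev, hev2] with n h1 h2 t x ht htT hx
    obtain ⟨p, hp, hpb⟩ := Set.mem_iUnion₂.1 (hcov (show (t, x) ∈ _ from ⟨⟨ht, htT⟩, abs_le.1 hx⟩))
    rw [Metric.mem_ball, Prod.dist_eq, max_lt_iff, Real.dist_eq, Real.dist_eq] at hpb
    obtain ⟨g1, g2⟩ := h1 t p.1 x p.2 ht (hcK hp).1.1 hpb.1 hpb.2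
    have g3 := h2 p hp
    rw [abs_le] at *
    constructor <;> linarith
  have hS : ∀ σ ∈ ({G.low, G.up} : Finset ℝ), 0 ≤ σ := by
    have := G.low_nonneg
    have := G.low_le_up
    intro σ hσ
    rcases Finset.mem_insert.1 hσ with rfl | h
    · assumption
    · rw [Finset.mem_singleton.1 h]; linarith
  refine ⟨u, hcont, ⟨C, fun t x _ => huC t x⟩, ?_, ?_, ?_⟩
  · intro x
    refine tendsto_nhds_unique (hu 0 x) ?_
    have : ∀ n, v n 0 x = φ x := fun n => by simp [hv, GFunction.approx]
    simp only [this]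
    exact tendsto_const_nhds
  · refine isViscSub_of_scheme hS hkpos hk0 hunif fun a n t x ht => ?_
    have h1 : v n t x = G.step (k n) (v n (t - k n ^ 2)) x := by
      simp only [hv]; rw [GFunction.approx_eq_step (hkpos n) ht]
    rw [h1, GFunction.step]
    rcases max_cases ((v n (t - k n ^ 2) (x + G.low * k n) + v n (t - k n ^ 2) (x - G.low * k n)) / 2)
      ((v n (t - k n ^ 2) (x + G.up * k n) + v n (t - k n ^ 2) (x - G.up * k n)) / 2) with h | h
    · exact ⟨G.low, by simp, G.low_mul_le_eval a, h.1.le⟩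
    · exact ⟨G.up, by simp, G.up_mul_le_eval a, h.1.le⟩
  · refine IsViscSub.supersolution (isViscSub_of_scheme (v := fun n t x => -v n t x) hS hkpos hk0
      (fun T R ε hε => ?_) fun a n t x ht => ?_)
    · filter_upwards [hunif T R ε hε] with n hn t x h1 h2 h3
      have := hn t x h1 h2 h3
      rwa [neg_sub_neg, abs_sub_comm]
    · have h1 : v n t x = G.step (k n) (v n (t - k n ^ 2)) x := by
        simp only [hv]; rw [GFunction.approx_eq_step (hkpos n) ht]
      rw [h1, GFunction.step]
      -- A step is at least each of its two averages, so for `-v` the scheme inequality holds with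
      -- either volatility; the one attaining `G (-a)` is chosen.
      rcases G.eval_eq_or (-a) with h | h
      · refine ⟨G.low, by simp, by rw [h]; linarith, ?_⟩
        have := le_max_left
          ((v n (t - k n ^ 2) (x + G.low * k n) + v n (t - k n ^ 2) (x - G.low * k n)) / 2)
          ((v n (t - k n ^ 2) (x + G.up * k n) + v n (t - k n ^ 2) (x - G.up * k n)) / 2)
        linarith
      · refine ⟨G.up, by simp, by rw [h]; linarith, ?_⟩
        have := le_max_right
          ((v n (t - k n ^ 2) (x + G.low * k n) + v n (t - k n ^ 2) (x - G.low * k n)) / 2)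
          ((v n (t - k n ^ 2) (x + G.up * k n) + v n (t - k n ^ 2) (x - G.up * k n)) / 2)
        linarith

/-! ### Uniqueness, scaling and classical solutions -/

namespace IsViscositySolution

variable {G : GFunction} {φ φ' : ℝ → ℝ} {u v : ℝ → ℝ → ℝ}

lemma le_of_initial_le (hu : IsViscositySolution G φ u) (hv : IsViscositySolution G φ' v)
    (h : ∀ x, φ x ≤ φ' x) {t : ℝ} (ht : 0 ≤ t) (x : ℝ) : u t x ≤ v t x := by
  obtain ⟨B, hB⟩ := hu.bounded
  obtain ⟨C, hC⟩ := hv.bounded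
  exact hu.subsolution.le_supersolution hv.supersolution hu.continuousOn hv.continuousOn
    (B := max B C) (fun t x ht => (hB t x ht).trans (le_max_left _ _))
    (fun t x ht => (hC t x ht).trans (le_max_right _ _))
    (fun x => by rw [hu.initial, hv.initial]; exact h x) ht x

lemma eq_of_initial_eq (hu : IsViscositySolution G φ u) (hv : IsViscositySolution G φ v)
    {t : ℝ} (ht : 0 ≤ t) (x : ℝ) : u t x = v t x :=
  le_antisymm (hu.le_of_initial_le hv (fun _ => le_rfl) ht x)
    (hv.le_of_initial_le hu (fun _ => le_rfl) ht x)

lemma gNormal_eq (hu : IsViscositySolution G φ u) : gNormal G φ = u 1 0 := by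
  have h : ∃ u, IsViscositySolution G φ u := ⟨u, hu⟩
  rw [gNormal, dif_pos h]
  exact h.choose_spec.eq_of_initial_eq hu zero_le_one 0

/-- Positive homogeneity of `G'` absorbs `c`, so only `ω ^ 2` and `lam` have to be balanced. The
three uses are the semigroup property, time change and parabolic scaling. -/
lemma comp_affine (hu : IsViscositySolution G φ u) {G' : GFunction} {c lam ω t₀ x₀ : ℝ}
    (hc : 0 < c) (hlam : 0 < lam) (hω : 0 < ω) (ht₀ : 0 ≤ t₀)
    (hG : ∀ a, G'.eval (ω ^ 2 * a) = lam * G.eval a) :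
    IsViscositySolution G' (fun x => c * u t₀ (ω * x + x₀))
      (fun t x => c * u (lam * t + t₀) (ω * x + x₀)) where
  continuousOn := by
    refine ContinuousOn.mul continuousOn_const (hu.continuousOn.comp
      (f := fun p : ℝ × ℝ => (lam * p.1 + t₀, ω * p.2 + x₀)) (by fun_prop) fun p hp => ?_)
    have hp' : 0 ≤ p.1 := hp
    show 0 ≤ lam * p.1 + t₀
    positivity
  bounded := by
    obtain ⟨B, hB⟩ := hu.bounded
    refine ⟨c * B, fun t x ht => ?_⟩
    rw [abs_mul, abs_of_pos hc]
    exact mul_le_mul_of_nonneg_left (hB _ _ (by positivity)) hc.le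
  initial := fun x => by simp
  subsolution := hu.subsolution.isViscSub.comp_affine hc hlam hω ht₀ fun a => by
    rw [mul_assoc, G'.eval_mul hc.le, hG]; ring
  supersolution := by
    refine IsViscSub.supersolution ?_
    have := hu.supersolution.isViscSub_neg.comp_affine (Γ' := fun a => -G'.eval (-a)) (x₀ := x₀)
      hc hlam hω ht₀ fun a => by
        have h1 : -(c * ω ^ 2 * a) = c * (ω ^ 2 * -a) := by ring
        rw [h1, G'.eval_mul hc.le, hG]; ring
    simpa only [mul_neg] using this

lemma shift (hu : IsViscositySolution G φ u) {t₀ : ℝ} (ht₀ : 0 ≤ t₀) :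
    IsViscositySolution G (u t₀) (fun t x => u (t + t₀) x) := by
  have := hu.comp_affine (G' := G) (x₀ := 0) one_pos one_pos one_pos ht₀ (by simp)
  simpa using this

end IsViscositySolution

/-- Were the second derivative positive, the point would be a local minimum too, so `f` would be
locally constant with vanishing second derivative. -/
lemma iteratedDeriv_two_nonpos_of_isLocalMax {f : ℝ → ℝ} {x : ℝ} (hf : ContinuousAt f x)
    (h : IsLocalMax f x) : iteratedDeriv 2 f x ≤ 0 := by
  rw [iteratedDeriv_two_eq]
  by_contra! hpos
  have hmin := isLocalMin_of_deriv_deriv_pos hpos h.deriv_eq_zero hf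
  have heq : f =ᶠ[𝓝 x] fun _ => f x := by
    filter_upwards [h, hmin] with y h1 h2 using le_antisymm h1 h2
  have h1 : deriv f =ᶠ[𝓝 x] fun _ => 0 := by
    refine heq.deriv.trans ?_
    simp
  rw [h1.deriv_eq] at hpos
  simp at hpos

/-- A classical subsolution is a viscosity subsolution. -/
lemma isViscSub_of_classical {Γ : ℝ → ℝ} {w : ℝ × ℝ → ℝ} (hΓ : Monotone Γ) (hw : ContDiff ℝ 2 w)
    (h : ∀ t x, 0 < t → deriv (fun s => w (s, x)) t ≤ Γ (iteratedDeriv 2 (fun y => w (t, y)) x)) :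
    IsViscSub Γ (fun t x => w (t, x)) := by
  intro ψ t x ht hψ hmax
  have hmt : IsLocalMax (fun s => w (s, x) - ψ (s, x)) t :=
    ((Continuous.tendsto (f := fun s : ℝ => (s, x)) (by fun_prop) t).eventually hmax)
  have hmx : IsLocalMax (fun y => w (t, y) - ψ (t, y)) x :=
    ((Continuous.tendsto (f := fun y : ℝ => (t, y)) (by fun_prop) x).eventually hmax)
  have hψt : ContDiffAt ℝ 2 (fun s => ψ (s, x)) t :=
    ContDiffAt.comp t (f := fun s : ℝ => (s, x)) hψ (by fun_prop)
  have hψx : ContDiffAt ℝ 2 (fun y => ψ (t, y)) x :=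
    ContDiffAt.comp x (f := fun y : ℝ => (t, y)) hψ (by fun_prop)
  have hwt := (contDiff_fst_section hw x).contDiffAt (x := t)
  have hwx := (contDiff_snd_section hw t).contDiffAt (x := x)
  have e1 := hmt.deriv_eq_zero
  rw [deriv_fun_sub (hwt.differentiableAt (by norm_num)) (hψt.differentiableAt (by norm_num))] at e1
  have e2 := iteratedDeriv_two_nonpos_of_isLocalMax (hwx.sub hψx).continuousAt hmx
  rw [iteratedDeriv_fun_sub hwx hψx] at e2
  have h1 := h t x ht
  have h2 := hΓ (sub_nonpos.1 e2)
  linarith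

/-- A bounded classical solution is a viscosity solution. -/
lemma isViscositySolution_of_classical {G : GFunction} {w : ℝ × ℝ → ℝ} {B : ℝ}
    (hw : ContDiff ℝ 2 w) (hB : ∀ t x, 0 ≤ t → |w (t, x)| ≤ B)
    (h : ∀ t x, deriv (fun s => w (s, x)) t = G.eval (iteratedDeriv 2 (fun y => w (t, y)) x)) :
    IsViscositySolution G (fun x => w (0, x)) (fun t x => w (t, x)) where
  continuousOn := hw.continuous.continuousOn
  bounded := ⟨B, hB⟩
  initial := fun _ => rfl
  subsolution := isViscSub_of_classical (fun _ _ hab => G.eval_mono hab) hw fun t x _ => (h t x).le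
  supersolution := by
    refine IsViscSub.supersolution (isViscSub_of_classical
      (fun a b hab => neg_le_neg (G.eval_mono (neg_le_neg hab))) hw.neg fun t x _ => ?_)
    have e1 : deriv (fun s => -w (s, x)) t = -deriv (fun s => w (s, x)) t := deriv.fun_neg
    have e2 : iteratedDeriv 2 (fun y => -w (t, y)) x = -iteratedDeriv 2 (fun y => w (t, y)) x :=
      iteratedDeriv_fun_neg 2 _ x
    simp only [e1, e2, neg_neg, h t x, le_refl]

/-- The value of the convolution in terms of viscosity solutions. -/
lemma functionalConv_eq {G₁ G₂ : GFunction} {φ : ℝ → ℝ} {u₂ u₁ : ℝ → ℝ → ℝ}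
    (h₂ : IsViscositySolution G₂ φ u₂) (h₁ : IsViscositySolution G₁ (u₂ 1) u₁) :
    functionalConv (gNormal G₁) (gNormal G₂) φ = u₁ 1 0 := by
  have h : (fun x => gNormal G₂ (fun y => φ (x + y))) = u₂ 1 := by
    funext x
    -- Translation invariance: the flow started from `φ (x + ·)` is the translated flow, so the
    -- inner functional is `u₂ 1 x`.
    have h3 := h₂.comp_affine (G' := G₂) (x₀ := x) one_pos one_pos one_pos le_rfl (by simp)
    have h4 : (fun y => 1 * u₂ 0 (1 * y + x)) = fun y => φ (x + y) := by
      funext y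
      rw [h₂.initial, one_mul, one_mul, add_comm]
    rw [h4] at h3
    rw [h3.gNormal_eq]
    simp
  rw [functionalConv, h, h₁.gNormal_eq]

/-! ### Equal ratios: the convolution is `G`-normal -/

/-- A single `G₁`-flow `u` serves for all three equations: at speed `lam` for `G₂`, shifted by `lam`
for the outer `G₁`, and at speed `1 + lam` for `G`. -/
theorem isGNormal_functionalConv_of_beta_eq {G₁ G₂ : GFunction} (h₁ : G₁.NonDegenerate)
    (h₂ : G₂.NonDegenerate) (h : G₁.beta = G₂.beta) :
    IsGNormal (functionalConv (gNormal G₁) (gNormal G₂)) := by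
  have hl₁ : 0 < G₁.low := h₁
  have hl₂ : 0 < G₂.low := h₂
  set lam := (G₂.low / G₁.low) ^ 2 with hlam
  have hlam0 : 0 < lam := by positivity
  have hlow : G₂.low ^ 2 = lam * G₁.low ^ 2 := by rw [hlam]; field_simp
  have hup : G₂.up ^ 2 = lam * G₁.up ^ 2 := by
    have h3 : G₁.up * G₂.low = G₂.up * G₁.low := by
      rw [GFunction.beta, GFunction.beta, div_eq_div_iff hl₁.ne' hl₂.ne'] at h
      exact h
    have h4 : G₂.up = G₁.up * G₂.low / G₁.low := by rw [h3]; field_simp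
    rw [h4, hlam]; field_simp
  have hG₂ : ∀ a, G₂.eval (1 ^ 2 * a) = lam * G₁.eval a := by
    intro a
    rw [GFunction.eval, GFunction.eval, hlow, hup, one_pow, one_mul]; ring
  have hsq : √(1 + lam) ^ 2 = 1 + lam := Real.sq_sqrt (by positivity)
  let G : GFunction := ⟨√(1 + lam) * G₁.low, √(1 + lam) * G₁.up, by positivity,
    mul_le_mul_of_nonneg_left G₁.low_le_up (Real.sqrt_nonneg _)⟩
  have hG : ∀ a, G.eval (1 ^ 2 * a) = (1 + lam) * G₁.eval a := by
    intro a
    simp only [GFunction.eval, G, mul_pow, hsq, one_pow, one_mul]; ring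
  refine ⟨G, fun φ hφ => ?_⟩
  obtain ⟨u, hu⟩ := exists_isViscositySolution G₁ hφ
  have s₂ := hu.comp_affine (G' := G₂) (x₀ := 0) one_pos hlam0 one_pos le_rfl hG₂
  have s := hu.comp_affine (G' := G) (x₀ := 0) one_pos (by positivity : 0 < 1 + lam) one_pos
    le_rfl hG
  have e : (fun x => 1 * u 0 (1 * x + 0)) = φ := by
    funext x; rw [hu.initial, one_mul, one_mul, add_zero]
  rw [e] at s s₂
  have s₁ : IsViscositySolution G₁ (fun x => 1 * u (lam * 1 + 0) (1 * x + 0))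
      (fun t x => u (t + lam) x) := by
    simpa using hu.shift hlam0.le
  rw [functionalConv_eq s₂ s₁, s.gNormal_eq]
  simp

/-! ### Periodic eigenfunctions -/

lemma hasDerivAt_glue {f g f' g' : ℝ → ℝ} {a : ℝ} (hf : ∀ x, HasDerivAt f (f' x) x)
    (hg : ∀ x, HasDerivAt g (g' x) x) (h : f a = g a) (h' : f' a = g' a) (x : ℝ) :
    HasDerivAt (fun y => if y ≤ a then f y else g y) (if x ≤ a then f' x else g' x) x := by
  rcases lt_trichotomy x a with hx | rfl | hx
  · rw [if_pos hx.le]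
    refine (hf x).congr_of_eventuallyEq ?_
    filter_upwards [Iio_mem_nhds hx] with y hy using if_pos (le_of_lt hy)
  · rw [if_pos le_rfl]
    have h1 : HasDerivWithinAt (fun y => if y ≤ x then f y else g y) (f' x) (Set.Iic x) x :=
      (hf x).hasDerivWithinAt.congr (fun y hy => if_pos hy) (if_pos le_rfl)
    have h2 : HasDerivWithinAt (fun y => if y ≤ x then f y else g y) (f' x) (Set.Ici x) x := by
      rw [h']
      refine (hg x).hasDerivWithinAt.congr (fun y hy => ?_) ?_
      · rcases (Set.mem_Ici.1 hy).eq_or_lt with rfl | hlt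
        · rw [if_pos le_rfl, h]
        · exact if_neg (not_le.2 hlt)
      · rw [if_pos le_rfl, h]
    have h3 := h1.union h2
    rwa [Set.Iic_union_Ici, hasDerivWithinAt_univ] at h3
  · rw [if_neg (not_le.2 hx)]
    refine (hg x).congr_of_eventuallyEq ?_
    filter_upwards [Ioi_mem_nhds hx] with y hy using if_neg (not_le.2 hy)

/-- `p` is the periodic solution of `p'' = -p⁺ / l² + p⁻ / U²` whose positive arcs are cosine arcs
of width `π l` (one of them centred at `0`) and whose negative arcs are cosine arcs of width
`π U`. -/
structure IsPeriodicProfile (l U : ℝ) (p : ℝ → ℝ) : Prop where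
  ode : ∃ p' : ℝ → ℝ, (∀ x, HasDerivAt p (p' x) x) ∧
    (∀ x, HasDerivAt p' (-(max (p x) 0 / l ^ 2) + max (-p x) 0 / U ^ 2) x) ∧ ∀ x, |p' x| ≤ 1
  bounded : ∀ x, |p x| ≤ l + U
  periodic : Function.Periodic p (Real.pi * (l + U))
  pos_arc : ∀ x, |x| ≤ Real.pi / 2 * l → p x = l * Real.cos (x / l)
  neg_arc : ∀ x, Real.pi / 2 * l ≤ |x| → |x| ≤ Real.pi / 2 * (l + U) →
    p x = -(U * Real.cos ((Real.pi / 2 * (l + U) - |x|) / U))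

/-- At the junctions both arcs have value `0`, the same slope `±1` and second derivative `0`, so
they glue to a `C²` function. The two arcs fill one period starting at `-a`, and `toIcoMod` repeats
them. -/
lemma exists_isPeriodicProfile {l U : ℝ} (hl : 0 < l) (hU : 0 < U) :
    ∃ p, IsPeriodicProfile l U p := by
  have hπ := Real.pi_pos
  set a := Real.pi / 2 * l with ha
  set L := Real.pi * (l + U) with hLdef
  have ha0 : 0 < a := by positivity
  have hL : 0 < L := by positivity
  have hLa : L = 2 * a + Real.pi * U := by rw [hLdef, ha]; ring
  have hal : a / l = Real.pi / 2 := by rw [ha]; field_simp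
  have hnal : -a / l = -(Real.pi / 2) := by rw [neg_div, hal]
  have hπU : 0 < Real.pi * U := by positivity
  -- the arcs and their derivatives
  set c : ℝ → ℝ := fun x => l * Real.cos (x / l) with hc
  set c' : ℝ → ℝ := fun x => -Real.sin (x / l) with hc'
  set c'' : ℝ → ℝ := fun x => -(Real.cos (x / l) / l) with hc''
  set s : ℝ → ℝ := fun x => -(U * Real.sin ((x - a) / U)) with hs
  set s' : ℝ → ℝ := fun x => -Real.cos ((x - a) / U) with hs'
  set s'' : ℝ → ℝ := fun x => Real.sin ((x - a) / U) / U with hs''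
  have dc : ∀ x, HasDerivAt c (c' x) x := fun x => by
    refine ((((hasDerivAt_id x).div_const l).cos).const_mul l).congr_deriv ?_
    simp only [hc', id]; field_simp
  have dc' : ∀ x, HasDerivAt c' (c'' x) x := fun x => by
    refine (((hasDerivAt_id x).div_const l).sin).neg.congr_deriv ?_
    simp only [hc'', id]; field_simp
  have ds : ∀ x, HasDerivAt s (s' x) x := fun x => by
    refine (((((hasDerivAt_id x).sub_const a).div_const U).sin).const_mul U).neg.congr_deriv ?_
    simp only [hs', id]; field_simp
  have ds' : ∀ x, HasDerivAt s' (s'' x) x := fun x => by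
    refine ((((hasDerivAt_id x).sub_const a).div_const U).cos).neg.congr_deriv ?_
    simp only [hs'', id]; field_simp
  have shiftL : ∀ x, (x + L - a) / U = (x + a) / U + Real.pi := fun x => by
    rw [hLa]; field_simp; ring
  have dsL : ∀ x, HasDerivAt (fun y => s (y + L)) (s' (x + L)) x := fun x =>
    (ds (x + L)).comp_add_const x L
  have dsL' : ∀ x, HasDerivAt (fun y => s' (y + L)) (s'' (x + L)) x := fun x =>
    (ds' (x + L)).comp_add_const x L
  set h : ℝ → ℝ := fun x => if x ≤ a then c x else s x with hh
  set h' : ℝ → ℝ := fun x => if x ≤ a then c' x else s' x with hh'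
  set p : ℝ → ℝ := fun x => h (toIcoMod hL (-a) x) with hp
  set p' : ℝ → ℝ := fun x => h' (toIcoMod hL (-a) x) with hp'
  have perp : Function.Periodic p L := fun x => by simp only [hp, toIcoMod_add_right]
  have perp' : Function.Periodic p' L := fun x => by simp only [hp', toIcoMod_add_right]
  -- right representation
  have r1 : ∀ x, -a ≤ x → x < a + Real.pi * U → toIcoMod hL (-a) x = x := fun x h1 h2 =>
    (toIcoMod_eq_self hL).2 ⟨h1, by rw [hLa]; linarith⟩
  have r2 : ∀ x, -a - Real.pi * U ≤ x → x < -a → toIcoMod hL (-a) x = x + L := by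
    intro x h1 h2
    rw [← toIcoMod_add_right]
    exact (toIcoMod_eq_self hL).2 ⟨by rw [hLa]; linarith, by linarith⟩
  -- A second description around `-a`, where the period begins: to its left stands the negative arc
  -- of the previous period. This makes the junction at `-a` accessible to gluing.
  have pl : ∀ x, -a - Real.pi * U < x → x < a →
      p x = (if x ≤ -a then s (x + L) else c x) ∧ p' x = (if x ≤ -a then s' (x + L) else c' x) := by
    intro x h1 h2
    rcases lt_trichotomy x (-a) with hx | rfl | hx
    · have h3 : ¬ x + L ≤ a := by rw [hLa]; linarith
      simp only [hp, hp', r2 x h1.le hx, hh, hh', if_neg h3, if_pos hx.le, and_self]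
    · have e1 : s (-a + L) = c (-a) := by
        simp only [hs, hc, shiftL, hnal]; simp
      have e2 : s' (-a + L) = c' (-a) := by
        simp only [hs', hc', shiftL, hnal]; simp
      have h3 : -a ≤ a := by linarith
      simp only [hp, hp', r1 (-a) le_rfl (by linarith), hh, hh', if_pos h3, if_pos le_rfl, e1, e2,
        and_self]
    · have h3 : x ≤ a := h2.le
      simp only [hp, hp', r1 x hx.le (by linarith), hh, hh', if_pos h3, if_neg (not_le.2 hx),
        and_self]
  -- the sign of the arcs
  have csign : ∀ x, -a ≤ x → x ≤ a → 0 ≤ c x := by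
    intro x h1 h2
    have k1 : x / l ≤ Real.pi / 2 := by rw [← hal]; gcongr
    have k2 : -(Real.pi / 2) ≤ x / l := by rw [← hnal]; gcongr
    exact mul_nonneg hl.le (Real.cos_nonneg_of_neg_pi_div_two_le_of_le k2 k1)
  have ssign : ∀ x, a ≤ x → x ≤ a + Real.pi * U → s x ≤ 0 := by
    intro x h1 h2
    have k1 : 0 ≤ (x - a) / U := div_nonneg (by linarith) hU.le
    have k2 : (x - a) / U ≤ Real.pi := by rw [div_le_iff₀ hU]; linarith
    exact neg_nonpos.2 (mul_nonneg hU.le (Real.sin_nonneg_of_nonneg_of_le_pi k1 k2))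
  have code : ∀ x, -a ≤ x → x ≤ a → c'' x = -(max (c x) 0 / l ^ 2) + max (-c x) 0 / U ^ 2 := by
    intro x h1 h2
    have := csign x h1 h2
    rw [max_eq_left this, max_eq_right (by linarith)]
    simp only [hc, hc'']; field_simp; ring
  have sode : ∀ x, a ≤ x → x ≤ a + Real.pi * U →
      s'' x = -(max (s x) 0 / l ^ 2) + max (-s x) 0 / U ^ 2 := by
    intro x h1 h2
    have := ssign x h1 h2
    rw [max_eq_right this, max_eq_left (by linarith)]
    simp only [hs, hs'']; field_simp; ring
  have key : ∀ x, -a ≤ x → x < a + Real.pi * U → HasDerivAt p (p' x) x ∧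
      HasDerivAt p' (-(max (p x) 0 / l ^ 2) + max (-p x) 0 / U ^ 2) x := by
    intro x h1 h2
    rcases h1.eq_or_lt with rfl | h1
    · have hx := pl (-a) (by linarith) (by linarith)
      have ev : ∀ᶠ y in 𝓝 (-a), -a - Real.pi * U < y ∧ y < a :=
        (lt_mem_nhds (by linarith)).and (gt_mem_nhds (by linarith))
      have e1 : s (-a + L) = c (-a) := by simp only [hs, hc, shiftL, hnal]; simp
      have e2 : s' (-a + L) = c' (-a) := by simp only [hs', hc', shiftL, hnal]; simp
      have e3 : s'' (-a + L) = c'' (-a) := by simp only [hs'', hc'', shiftL, hnal]; simp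
      have d1 := hasDerivAt_glue dsL dc e1 e2 (-a)
      have d2 := hasDerivAt_glue dsL' dc' e2 e3 (-a)
      refine ⟨?_, ?_⟩
      · rw [hx.2]
        exact d1.congr_of_eventuallyEq (ev.mono fun y hy => (pl y hy.1 hy.2).1)
      · have e4 : p (-a) = c (-a) := by rw [hx.1, if_pos le_rfl, e1]
        rw [e4, ← code (-a) le_rfl (by linarith)]
        rw [if_pos le_rfl, e3] at d2
        exact d2.congr_of_eventuallyEq (ev.mono fun y hy => (pl y hy.1 hy.2).2)
    · have ev : ∀ᶠ y in 𝓝 x, -a < y ∧ y < a + Real.pi * U :=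
        (lt_mem_nhds h1).and (gt_mem_nhds h2)
      have e1 : c a = s a := by simp only [hs, hc, hal]; simp
      have e2 : c' a = s' a := by simp only [hs', hc', hal]; simp
      have e3 : c'' a = s'' a := by simp only [hs'', hc'', hal]; simp
      have pr : ∀ y, -a < y ∧ y < a + Real.pi * U → p y = h y ∧ p' y = h' y := fun y hy => by
        simp only [hp, hp', r1 y hy.1.le hy.2, and_self]
      have d1 := hasDerivAt_glue dc ds e1 e2 x
      have d2 := hasDerivAt_glue dc' ds' e2 e3 x
      refine ⟨?_, ?_⟩
      · rw [(pr x ⟨h1, h2⟩).2]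
        exact d1.congr_of_eventuallyEq (ev.mono fun y hy => (pr y hy).1)
      · refine (d2.congr_of_eventuallyEq (ev.mono fun y hy => (pr y hy).2)).congr_deriv ?_
        rw [(pr x ⟨h1, h2⟩).1]
        simp only [hh]
        split_ifs with hxa
        · exact code x h1.le hxa
        · exact sode x (not_le.1 hxa).le h2.le
  have hred : ∀ x, HasDerivAt p (p' x) x ∧
      HasDerivAt p' (-(max (p x) 0 / l ^ 2) + max (-p x) 0 / U ^ 2) x := by
    intro x
    set n := toIcoDiv hL (-a) x with hn
    have hmem := toIcoMod_mem_Ico hL (-a) x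
    have hx : toIcoMod hL (-a) x = x - n * L := by
      rw [toIcoMod, zsmul_eq_mul]
    rw [hx] at hmem
    obtain ⟨k1, k2⟩ := key (x - n * L) hmem.1 (by rw [hLa] at hmem ⊢; linarith [hmem.2])
    have q1 : ∀ y, p (y - n * L) = p y := fun y => perp.sub_int_mul_eq n
    have q2 : ∀ y, p' (y - n * L) = p' y := fun y => perp'.sub_int_mul_eq n
    have d1 := k1.comp_sub_const x (n * L)
    have d2 := k2.comp_sub_const x (n * L)
    simp only [q1, q2] at d1 d2
    exact ⟨d1, d2⟩
  refine ⟨p, ⟨p', fun x => (hred x).1, fun x => (hred x).2, fun x => ?_⟩, fun x => ?_, perp, ?_, ?_⟩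
  · simp only [hp', hh', hc', hs']
    split_ifs
    · rw [abs_neg]; exact Real.abs_sin_le_one _
    · rw [abs_neg]; exact Real.abs_cos_le_one _
  · simp only [hp, hh, hc, hs]
    split_ifs
    · rw [abs_mul, abs_of_pos hl]
      nlinarith [Real.abs_cos_le_one (toIcoMod hL (-a) x / l)]
    · rw [abs_neg, abs_mul, abs_of_pos hU]
      nlinarith [Real.abs_sin_le_one ((toIcoMod hL (-a) x - a) / U)]
  · intro x hx
    have hx' : -a ≤ x ∧ x ≤ a := abs_le.1 hx
    simp only [hp, r1 x hx'.1 (by linarith), hh, if_pos hx'.2, hc]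
  · intro x h1 h2
    have h2' : |x| ≤ a + Real.pi * U / 2 := by rw [ha]; linarith
    have hE : ∀ z, (Real.pi / 2 * (l + U) - z) / U = Real.pi / 2 - (z - a) / U := by
      intro z; rw [ha]; field_simp; ring
    rw [hE, Real.cos_pi_div_two_sub]
    rcases le_total 0 x with hx0 | hx0
    · rw [abs_of_nonneg hx0] at *
      simp only [hp, r1 x (by linarith) (by linarith), hh]
      split_ifs with hxa
      · have : x = a := le_antisymm hxa h1
        subst this
        simp only [hc, hal]; simp
      · rfl
    · rw [abs_of_nonpos hx0] at *
      rw [(pl x (by linarith) (by linarith)).1, if_pos (by linarith)]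
      simp only [hs, shiftL, Real.sin_add_pi]
      have : (-x - a) / U = -((x + a) / U) := by ring
      rw [this, Real.sin_neg]

/-- Widening a cosine arc about its centre also raises it, since both the amplitude and the cosine
grow with `σ`. -/
lemma mul_cos_div_lt {σ σ' x : ℝ} (hσ : 0 < σ) (h : σ < σ') (hx : 0 ≤ x)
    (hxσ : x ≤ Real.pi / 2 * σ) : σ * Real.cos (x / σ) < σ' * Real.cos (x / σ') := by
  have hπ := Real.pi_pos
  have hσ' : 0 < σ' := hσ.trans h
  have h1 : x / σ ≤ Real.pi / 2 := (div_le_iff₀ hσ).2 hxσ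
  have h2 : 0 ≤ Real.cos (x / σ) := Real.cos_nonneg_of_neg_pi_div_two_le_of_le
    (by have : 0 ≤ x / σ := by positivity
        linarith) h1
  rcases hx.eq_or_lt with rfl | hx
  · simpa using h
  · have h3 : x / σ' < x / σ := by gcongr
    have h4 : Real.cos (x / σ) < Real.cos (x / σ') :=
      Real.cos_lt_cos_of_nonneg_of_le_pi (by positivity) (by linarith) h3
    calc σ * Real.cos (x / σ) ≤ σ' * Real.cos (x / σ) := by gcongr
      _ < _ := by gcongr

namespace IsPeriodicProfile

variable {l U l' U' : ℝ} {p q : ℝ → ℝ}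

/-- The periods agree, positive arcs are centred at `0` and negative ones at half a period.
Increasing `l` widens and raises the former, narrows and flattens the latter, and in between `p ≤ 0
≤ q`. -/
lemma lt_of_low_lt (hp : IsPeriodicProfile l U p) (hq : IsPeriodicProfile l' U' q) (hl : 0 < l)
    (hU' : 0 < U') (hll : l < l') (hsum : l + U = l' + U') (x : ℝ) : p x < q x := by
  have hπ := Real.pi_pos
  have hU : 0 < U := by linarith
  have hl' : 0 < l' := by linarith
  have hL : 0 < Real.pi * (l + U) := by positivity
  wlog hx : |x| ≤ Real.pi / 2 * (l + U) generalizing x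
  · have hmem := toIcoMod_mem_Ico hL (-(Real.pi / 2 * (l + U))) x
    have h1 := this (toIcoMod hL (-(Real.pi / 2 * (l + U))) x)
      (abs_le.2 ⟨hmem.1, by linarith [hmem.2]⟩)
    have hqp : Function.Periodic q (Real.pi * (l + U)) := by rw [hsum]; exact hq.periodic
    rwa [toIcoMod, hp.periodic.sub_zsmul_eq, hqp.sub_zsmul_eq] at h1
  have habs : ∀ σ, Real.cos (x / σ) = Real.cos (|x| / σ) := by
    intro σ
    rcases abs_choice x with h | h <;> rw [h]
    rw [neg_div, Real.cos_neg]
  rcases le_total |x| (Real.pi / 2 * l) with h1 | h1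
  · rw [hp.pos_arc x h1, hq.pos_arc x (h1.trans (by gcongr)), habs l, habs l']
    exact mul_cos_div_lt hl hll (abs_nonneg x) h1
  rw [hp.neg_arc x h1 hx]
  rcases le_total |x| (Real.pi / 2 * l') with h2 | h2
  · rw [hq.pos_arc x h2, habs l']
    have a1 : 0 ≤ (Real.pi / 2 * (l + U) - |x|) / U := div_nonneg (by linarith) hU.le
    have a2 : (Real.pi / 2 * (l + U) - |x|) / U ≤ Real.pi / 2 := by
      rw [div_le_iff₀ hU]; linarith
    have a3 : |x| / l' ≤ Real.pi / 2 := by rwa [div_le_iff₀ hl']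
    have a4 : 0 ≤ |x| / l' := by positivity
    have c1 : 0 ≤ Real.cos ((Real.pi / 2 * (l + U) - |x|) / U) :=
      Real.cos_nonneg_of_neg_pi_div_two_le_of_le (by linarith) a2
    have c2 : 0 ≤ Real.cos (|x| / l') := Real.cos_nonneg_of_neg_pi_div_two_le_of_le (by linarith) a3
    -- Strictness in the mixed zone: before the zero of `q` at `π / 2 * l'` one has `q > 0`, and at
    -- that zero `p` is already negative.
    rcases h2.lt_or_eq with h3 | h3
    · have : 0 < Real.cos (|x| / l') := Real.cos_pos_of_mem_Ioo
        ⟨by linarith, by rwa [div_lt_iff₀ hl']⟩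
      have g1 : 0 < l' * Real.cos (|x| / l') := by positivity
      have g2 : 0 ≤ U * Real.cos ((Real.pi / 2 * (l + U) - |x|) / U) := by positivity
      linarith
    · have h4 : Real.pi / 2 * l < Real.pi / 2 * l' := by gcongr
      have : 0 < Real.cos ((Real.pi / 2 * (l + U) - |x|) / U) := Real.cos_pos_of_mem_Ioo
        ⟨by linarith, by rw [div_lt_iff₀ hU]; linarith⟩
      have g1 : 0 ≤ l' * Real.cos (|x| / l') := by positivity
      have g2 : 0 < U * Real.cos ((Real.pi / 2 * (l + U) - |x|) / U) := by positivity
      linarith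
  · rw [hq.neg_arc x h2 (by rwa [← hsum]), ← hsum]
    refine neg_lt_neg (mul_cos_div_lt hU' (by linarith) (by linarith) ?_)
    rw [hsum]; linarith

protected lemma continuous (hp : IsPeriodicProfile l U p) : Continuous p := by
  obtain ⟨p', h, -, -⟩ := hp.ode
  exact continuous_iff_continuousAt.2 fun x => (h x).continuousAt

lemma exists_add_le_of_low_lt (hp : IsPeriodicProfile l U p) (hq : IsPeriodicProfile l' U' q)
    (hl : 0 < l) (hU' : 0 < U') (hll : l < l') (hsum : l + U = l' + U') :
    ∃ k, 0 < k ∧ ∀ x, p x + k ≤ q x := by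
  have hL : 0 < Real.pi * (l + U) := by
    have := Real.pi_pos
    have : 0 < l + U := by rw [hsum]; linarith
    positivity
  obtain ⟨y, _, hy⟩ := (isCompact_Icc (a := 0) (b := Real.pi * (l + U))).exists_isMinOn
    ⟨0, le_rfl, hL.le⟩ (hq.continuous.sub hp.continuous).continuousOn
  refine ⟨q y - p y, sub_pos.2 (hp.lt_of_low_lt hq hl hU' hll hsum y), fun x => ?_⟩
  have hmem := toIcoMod_mem_Ico hL 0 x
  have h1 : q y - p y ≤ q (toIcoMod hL 0 x) - p (toIcoMod hL 0 x) :=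
    hy ⟨hmem.1, by linarith [hmem.2]⟩
  have hqp : Function.Periodic q (Real.pi * (l + U)) := by rw [hsum]; exact hq.periodic
  rw [toIcoMod, hp.periodic.sub_zsmul_eq, hqp.sub_zsmul_eq] at h1
  linarith

lemma boundedLipschitz (hp : IsPeriodicProfile l U p) (a b : ℝ) :
    BoundedLipschitz (fun x => p (a * x + b)) := by
  obtain ⟨p', h, -, hb⟩ := hp.ode
  refine ⟨⟨l + U, fun x => hp.bounded _⟩, Real.nnabs a, ?_⟩
  have h1 : LipschitzWith 1 p := lipschitzWith_of_nnnorm_deriv_le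
    (fun x => (h x).differentiableAt) fun x => by
      rw [(h x).deriv, ← NNReal.coe_le_coe]
      simpa using hb x
  refine LipschitzWith.of_dist_le_mul fun x y => ?_
  have h2 := h1.dist_le_mul (a * x + b) (a * y + b)
  simp only [Real.dist_eq, NNReal.coe_one, one_mul, add_sub_add_right_eq_sub, ← mul_sub,
    abs_mul] at h2
  simpa [Real.dist_eq] using h2

/-- The profile decays exponentially under the `G`-heat flow. -/
lemma isViscositySolution (hp : IsPeriodicProfile l U p) {G : GFunction} {ω : ℝ} (hl : 0 < l)
    (hU : 0 < U) (hlow : G.low = ω * l) (hup : G.up = ω * U) (k : ℝ) :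
    IsViscositySolution G (fun x => p x + k)
      (fun t x => Real.exp (-(ω ^ 2 / 2) * t) * p x + k) := by
  obtain ⟨p', h1, h2, -⟩ := hp.ode
  have hc : ContDiff ℝ 2 p := by
    have e1 : deriv p = p' := funext fun x => (h1 x).deriv
    have e2 : deriv p' = fun x => -(max (p x) 0 / l ^ 2) + max (-p x) 0 / U ^ 2 :=
      funext fun x => (h2 x).deriv
    have hpc := hp.continuous
    have h3 : ContDiff ℝ 1 p' := by
      rw [contDiff_one_iff_deriv, e2]
      exact ⟨fun x => (h2 x).differentiableAt, by fun_prop⟩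
    refine (contDiff_succ_iff_deriv (n := 1)).2 ⟨fun x => (h1 x).differentiableAt, by simp, ?_⟩
    rwa [e1]
  have hsol := isViscositySolution_of_classical (G := G) (B := l + U + |k|)
    (w := fun q : ℝ × ℝ => Real.exp (-(ω ^ 2 / 2) * q.1) * p q.2 + k) (by fun_prop) ?_ ?_
  · simpa using hsol
  · intro t x ht
    refine (abs_add_le _ _).trans (add_le_add_left ?_ _)
    rw [abs_mul, Real.abs_exp]
    have e1 : Real.exp (-(ω ^ 2 / 2) * t) ≤ 1 := Real.exp_le_one_iff.2 (by
      have : 0 ≤ ω ^ 2 / 2 * t := by positivity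
      linarith)
    have e2 := hp.bounded x
    have e3 := abs_nonneg (p x)
    nlinarith
  · intro t x
    set e := Real.exp (-(ω ^ 2 / 2) * t) with he
    have d1 : HasDerivAt (fun s => Real.exp (-(ω ^ 2 / 2) * s) * p x + k)
        (e * -(ω ^ 2 / 2) * p x) t := by
      have := (((hasDerivAt_id t).const_mul (-(ω ^ 2 / 2))).exp.mul_const (p x)).add_const k
      simpa [he] using this
    have hepos : 0 ≤ e := (Real.exp_pos _).le
    have d2 : deriv (fun y => e * p y + k) = fun y => e * p' y :=
      funext fun y => (((h1 y).const_mul e).add_const k).deriv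
    change deriv (fun s => Real.exp (-(ω ^ 2 / 2) * s) * p x + k) t =
      G.eval (iteratedDeriv 2 (fun y => e * p y + k) x)
    rw [iteratedDeriv_two_eq, d1.deriv, d2, ((h2 x).const_mul e).deriv, G.eval_mul hepos]
    clear_value e
    -- On positive arcs `p'' ≤ 0` selects `G.low`, on negative arcs `p'' ≥ 0` selects `G.up`; the
    -- widths are matched so that both give the rate `ω ^ 2 / 2`.
    rcases le_total 0 (p x) with hx | hx
    · rw [max_eq_left hx, max_eq_right (by linarith), zero_div, add_zero,
        G.eval_eq_of_nonpos (by rw [neg_nonpos]; positivity), hlow]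
      field_simp
    · rw [max_eq_right hx, max_eq_left (by linarith), zero_div, neg_zero, zero_add,
        G.eval_eq_of_nonneg (div_nonneg (by linarith) (by positivity)), hup]
      field_simp

end IsPeriodicProfile

/-! ### Different ratios: the convolution is not `G`-normal -/

lemma isViscositySolution_const (G : GFunction) (k : ℝ) :
    IsViscositySolution G (fun _ => k) (fun _ _ => k) := by
  refine isViscositySolution_of_classical (w := fun _ => k) (B := |k|) contDiff_const
    (fun _ _ _ => le_rfl) fun t x => ?_
  rw [iteratedDeriv_two_eq]
  simp [GFunction.eval]

lemma exists_exp_mul_lt {a M ε : ℝ} (ha : 0 < a) (hε : 0 < ε) (t₀ : ℝ) :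
    ∃ t, t₀ ≤ t ∧ 0 < t ∧ Real.exp (-a * t) * M < ε := by
  have h1 : Tendsto (fun t => Real.exp (-a * t) * M) atTop (𝓝 (0 * M)) := by
    refine (Real.tendsto_exp_atBot.comp ?_).mul_const M
    exact tendsto_id.const_mul_atTop_of_neg (by linarith)
  rw [zero_mul] at h1
  obtain ⟨t, ht⟩ := ((h1.eventually (gt_mem_nhds hε)).and
    ((eventually_ge_atTop t₀).and (eventually_gt_atTop 0))).exists
  exact ⟨t, ht.2.1, ht.2.2, ht.1⟩

theorem beta_eq_of_isGNormal {G₁ G₂ : GFunction} (h₁ : G₁.NonDegenerate)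
    (h₂ : G₂.NonDegenerate) (h : IsGNormal (functionalConv (gNormal G₁) (gNormal G₂))) :
    G₁.beta = G₂.beta := by
  have hl₁ : 0 < G₁.low := h₁
  have hl₂ : 0 < G₂.low := h₂
  have hu₁ : 0 < G₁.up := hl₁.trans_le G₁.low_le_up
  have hu₂ : 0 < G₂.up := hl₂.trans_le G₂.low_le_up
  obtain ⟨G, hG⟩ := h
  obtain ⟨p, hp⟩ := exists_isPeriodicProfile hl₂ hu₂
  have hpL : BoundedLipschitz p := by simpa using hp.boundedLipschitz 1 0
  obtain ⟨u, hu⟩ := exists_isViscositySolution G hpL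
  obtain ⟨v, hv⟩ := exists_isViscositySolution G₁ hpL
  -- the flow of `G` is the flow of `G₁` with additional exponential decay
  have hid : ∀ t x, 0 < t → u t x = Real.exp (-(1 / 2) * t) * v t x := by
    intro t x ht
    set r := √t with hr
    have hr0 : 0 < r := Real.sqrt_pos.2 ht
    have hr2 : r ^ 2 = t := Real.sq_sqrt ht.le
    have hscale : ∀ H : GFunction, ∀ a, H.eval (r ^ 2 * a) = t * H.eval a := fun H a => by
      rw [hr2, H.eval_mul ht.le]
    -- Parabolic scaling: testing on `p (r * · + x)` with `r ^ 2 = t` turns the single evaluation at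
    -- `(1, 0)` into one at `(t, x)`. The `G₂`-flow contributes just the factor `exp(-t / 2)`.
    have s₂ := (hp.isViscositySolution (G := G₂) (ω := 1) hl₂ hu₂ (by simp) (by simp) 0).comp_affine
      (x₀ := x) one_pos ht hr0 le_rfl (hscale G₂)
    have s₁ := hv.comp_affine (c := Real.exp (-(1 / 2) * t)) (x₀ := x) (Real.exp_pos _) ht hr0 le_rfl
      (hscale G₁)
    have s := hu.comp_affine (x₀ := x) one_pos ht hr0 le_rfl (hscale G)
    simp only [hv.initial, hu.initial, one_mul, add_zero, one_pow, mul_zero, Real.exp_zero] at s s₁ s₂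
    have e := functionalConv_eq s₂ (by simpa using s₁)
    rw [hG _ (hp.boundedLipschitz r x), s.gNormal_eq] at e
    simpa using e
  have hvB : ∃ M, ∀ t x, 0 ≤ t → |v t x| ≤ M := hv.bounded
  obtain ⟨M, hM⟩ := hvB
  have hdecay : ∀ T k, 0 < T → 0 < k → ∃ t, 0 < t ∧ |u (t + T) 0| < k := by
    intro T k hT hk
    obtain ⟨t, hTt, _, ht⟩ := exists_exp_mul_lt (M := M) one_half_pos hk (T + 1)
    refine ⟨t - T, by linarith, ?_⟩
    rw [sub_add_cancel, hid t 0 (by linarith), abs_mul, Real.abs_exp]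
    exact (mul_le_mul_of_nonneg_left (hM t 0 (by linarith)) (Real.exp_pos _).le).trans_lt ht
  -- profiles of `G₁` with the same period
  set ω := (G₁.low + G₁.up) / (G₂.low + G₂.up) with hω
  have hω0 : 0 < ω := by positivity
  have hl0 : 0 < G₁.low / ω := by positivity
  have hU0 : 0 < G₁.up / ω := by positivity
  obtain ⟨q, hq⟩ := exists_isPeriodicProfile hl0 hU0
  have hsum : G₁.low / ω + G₁.up / ω = G₂.low + G₂.up := by
    rw [← add_div, hω]; field_simp
  have hqs := fun k => hq.isViscositySolution (G := G₁) (ω := ω) hl0 hU0 (by field_simp)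
    (by field_simp) k
  have hqsmall : ∀ k, 0 < k → ∃ T, 0 < T ∧ ∀ x, |Real.exp (-(ω ^ 2 / 2) * T) * q x| < k := by
    intro k hk
    obtain ⟨T, _, hT, h⟩ := exists_exp_mul_lt (a := ω ^ 2 / 2) (M := G₁.low / ω + G₁.up / ω)
      (by positivity) hk 0
    refine ⟨T, hT, fun x => ?_⟩
    rw [abs_mul, Real.abs_exp]
    exact (mul_le_mul_of_nonneg_left (hq.bounded x) (Real.exp_pos _).le).trans_lt h
  rcases lt_trichotomy (G₁.low / ω) G₂.low with hlt | heq | hgt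
  · exfalso
    -- Here `q + k ≤ p`. Once the flow of `q` is below `k / 2` in absolute value, `v ≥ k / 2`, so `u
    -- ≥ k' > 0` at time `T` and, constants being solutions, ever after.
    obtain ⟨k, hk, hle⟩ := hq.exists_add_le_of_low_lt hp hl0 hu₂ hlt hsum
    obtain ⟨T, hT, hsmall⟩ := hqsmall (k / 2) (by positivity)
    set k' := Real.exp (-(1 / 2) * T) * (k / 2) with hk'
    have hk'0 : 0 < k' := by positivity
    have huT : ∀ x, k' ≤ u T x := by
      intro x
      rw [hid T x hT, hk']
      have h3 := (hqs k).le_of_initial_le hv hle hT.le x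
      have h4 := (abs_lt.1 (hsmall x)).1
      gcongr
      linarith
    obtain ⟨t, ht, htk⟩ := hdecay T k' hT hk'0
    have h5 := (isViscositySolution_const G k').le_of_initial_le (hu.shift hT.le) huT ht.le 0
    have h6 := (abs_lt.1 htk).2
    linarith
  · have hU : G₁.up / ω = G₂.up := by linarith
    rw [GFunction.beta, GFunction.beta, ← heq, ← hU]
    field_simp
  · exfalso
    -- The mirror case: `p ≤ q - k` forces `u ≤ -k'` from time `T` on.
    obtain ⟨k, hk, hle⟩ := hp.exists_add_le_of_low_lt hq hl₂ hU0 hgt hsum.symm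
    obtain ⟨T, hT, hsmall⟩ := hqsmall (k / 2) (by positivity)
    set k' := Real.exp (-(1 / 2) * T) * (k / 2) with hk'
    have hk'0 : 0 < k' := by positivity
    have huT : ∀ x, u T x ≤ -k' := by
      intro x
      rw [hid T x hT, hk', ← mul_neg]
      have h3 := hv.le_of_initial_le (hqs (-k)) (fun x => by linarith [hle x]) hT.le x
      have h4 := (abs_lt.1 (hsmall x)).2
      gcongr
      linarith
    obtain ⟨t, ht, htk⟩ := hdecay T k' hT hk'0
    have h5 := (hu.shift hT.le).le_of_initial_le (isViscositySolution_const G (-k')) huT ht.le 0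
    have h6 := (abs_lt.1 htk).1
    linarith

theorem theorem1 (G₁ G₂ : GFunction) (h₁ : G₁.NonDegenerate) (h₂ : G₂.NonDegenerate) :
    IsGNormal (functionalConv (gNormal G₁) (gNormal G₂)) ↔ G₁.beta = G₂.beta :=
  ⟨beta_eq_of_isGNormal h₁ h₂, isGNormal_functionalConv_of_beta_eq h₁ h₂⟩
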